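/- Let $\Sigma$ be a complete smooth fan in $N_{\mathbb R}=\mathbb R^n$, $N=\mathbb Z^n$, with primitive ray generators $b_1,\dots,b_r$, whose toric variety is Fano (that is, $D_1+\dots+D_r$ lies in the interior of the nef cone). Put $M=\mathrm{Hom}(N,\mathbb Z)$, $M_T=M_{\mathbb R}/M$, $P=\{x\in M_{\mathbb R}:\langle x,b_i\rangle\le 1\ \forall i\}$, and let $$\Lambda=\bigcup_{\sigma\in\Sigma}(\sigma^\perp/M)\times(-\sigma)\subset T^*M_T=M_T\times N_{\mathbb R}$$ be the FLTZ skeleton. A continuous convex function $\varphi:M_{\mathbb R}\to\mathbb R$, homogeneous of degree two and smooth with positive definite Hessian on $M_{\mathbb R}\setminus 0$, which on each positive dimensional face $F$ of $P$ attains its minimum in the relative interior of $F$, defines the identification $$\Psi:(\mathbb C^*)^n=M_T\times M_{\mathbb R}\to M_T\times N_{\mathbb R}=T^*M_T,\qquad \Psi(\theta,\rho)=(\theta,-d\varphi|_\rho),$$ where $Y_j=e^{\rho_j+2\pi i\theta_j}$. Such a $\varphi$ can be chosen, depending only on $\Sigma$, so that the following holds. Let $e_1,\dots,e_{\mathfrak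 p}$ be any $\mathbb Z$-basis of $\mathbb L=\ker(\mathbb Z^r\to N)$ whose dual basis consists of nef classes, let $\eta:\mathbb Z^r\to\mathbb L$, $\eta(\tilde b_i)=\sum_a\eta_{ia}e_a$, be any splitting of $\mathbb L\subset\mathbb Z^r$, and let $$W_q(Y)=\sum_{i=1}^r\Big(\prod_a q_a^{\eta_{ia}}\Big)Y^{b_i},\qquad U_{\epsilon,\epsilon'}=\{q\in(\mathbb C^*)^{\mathfrak p}:|q_a|<\epsilon,\ -\epsilon'<\arg q_a<\epsilon'\ \forall a\}.$$ For all $\epsilon''>0$ and $\epsilon>0$ there is $\epsilon'>0$ such that for every $q\in U_{\epsilon,\epsilon'}$: (i) there are a conical open set $V\subset T^*M_T\setminus M_T$ containing $\Lambda\setminus M_T$ and a compact set $K\subset T^*M_T$ such that $W_q(\Psi^{-1}(V\setminus K))\subset\{w\in\mathbb C^*:|\arg w|<\epsilon''\}$; (ii) for every $z\in\mathbb C^*$ with $|\arg z|\le\frac{\pi}{2}-\epsilon''$ and every $F\in\mathrm{Sh}^w_\Lambda(M_T)$ (a compact object of the category of complexes of sheaves of $\mathbb C$-vector spaces on $M_T$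 with singular support in $\Lambda$), the integral $\int_{\Psi^{-1}(CC(F))}e^{-W_q/z}\,\Omega$ over the characteristic cycle $CC(F)$, where $\Omega=\frac{dY_1\cdots dY_n}{Y_1\cdots Y_n}$, converges absolutely. In particular, for every $z$ with $|\arg z|<\frac\pi2$ and every $\epsilon>0$ these integrals converge for all $q$ in some $U_{\epsilon,\epsilon'}$. -/

import Mathlib

open CategoryTheory CategoryTheory.Limits TopologicalSpace MeasureTheory
open scoped ContDiff

/-! ## Smooth complete fans

Coordinates are fixed: `N = ℤⁿ`, `M = Hom(N, ℤ) = ℤⁿ`, and the pairing of `M_ℝ` and `N_ℝ` is the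
dot product. -/

/-- An integral vector viewed in `ℝⁿ`. -/
def intVec {n : ℕ} (a : Fin n → ℤ) : Fin n → ℝ := fun j => (a j : ℝ)

/-- The convex cone in `N_ℝ` generated by the vectors `b i`, `i ∈ s`. -/
def coneOf {n r : ℕ} (b : Fin r → Fin n → ℤ) (s : Finset (Fin r)) : Set (Fin n → ℝ) :=
  {v | ∃ c : Fin r → ℝ, (∀ i, 0 ≤ c i) ∧ v = ∑ i ∈ s, c i • intVec (b i)}

/-- A smooth complete (hence simplicial) fan in `ℝⁿ` with `r` rays. `ray i` is the primitive
generator `b_i` of the `i`-th ray, and a cone is recorded by the set of indices of its rays. -/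
structure SmoothCompleteFan (n r : ℕ) where
  ray : Fin r → Fin n → ℤ
  cones : Set (Finset (Fin r))
  face_mem : ∀ s ∈ cones, ∀ t, t ⊆ s → t ∈ cones
  ray_mem : ∀ i, {i} ∈ cones
  simplicial : ∀ s ∈ cones, LinearIndependent ℝ (fun i : s => intVec (ray i))
  inter_eq : ∀ s ∈ cones, ∀ t ∈ cones, coneOf ray s ∩ coneOf ray t = coneOf ray (s ∩ t)
  complete : ∀ v : Fin n → ℝ, ∃ s ∈ cones, v ∈ coneOf ray s
  smooth : ∀ s ∈ cones, s.card = n → Submodule.span ℤ (ray '' (s : Set (Fin r))) = ⊤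

namespace SmoothCompleteFan

variable {n r : ℕ}

/-- The cone of `N_ℝ` with index set `s`. -/
def cone (S : SmoothCompleteFan n r) (s : Finset (Fin r)) : Set (Fin n → ℝ) := coneOf S.ray s

/-- `𝕃 = ker (ℤʳ → N)`, the lattice of relations between the ray generators. -/
def relLattice (S : SmoothCompleteFan n r) : Submodule ℤ (Fin r → ℤ) :=
  LinearMap.ker (Fintype.linearCombination ℤ S.ray)

/-- `𝕃_ℝ = ker (ℝʳ → N_ℝ)`. -/
def relSpace (S : SmoothCompleteFan n r) : Submodule ℝ (Fin r → ℝ) :=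
  LinearMap.ker (Fintype.linearCombination ℝ fun i => intVec (S.ray i))

/-- The divisor class `D_i ∈ 𝕃^∨_ℝ`: the `i`-th coordinate restricted to `𝕃_ℝ`. -/
def divisorClass (S : SmoothCompleteFan n r) (i : Fin r) : StrongDual ℝ S.relSpace :=
  (ContinuousLinearMap.proj (R := ℝ) (φ := fun _ : Fin r => ℝ) i).comp S.relSpace.subtypeL

/-- The cone `Nef_σ ⊆ 𝕃^∨_ℝ` generated by the `D_i` with `b_i ∉ σ`. -/
def nefOf (S : SmoothCompleteFan n r) (s : Finset (Fin r)) : Set (StrongDual ℝ S.relSpace) :=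
  {f | ∃ c : Fin r → ℝ, (∀ i, 0 ≤ c i) ∧ (∀ i ∈ s, c i = 0) ∧ f = ∑ i, c i • S.divisorClass i}

/-- The nef cone: the intersection of `Nef_σ` over the `n`-dimensional cones `σ`. -/
def nefCone (S : SmoothCompleteFan n r) : Set (StrongDual ℝ S.relSpace) :=
  {f | ∀ s ∈ S.cones, s.card = n → f ∈ S.nefOf s}

/-- The Fano condition: `c₁ = D_1 + ⋯ + D_r` lies in the Kähler cone, the interior of the nef
cone. -/
def IsFano (S : SmoothCompleteFan n r) : Prop :=
  ∑ i, S.divisorClass i ∈ interior S.nefCone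

/-- A ℤ-basis `e` of `𝕃` such that every element `e_a^∨` of the dual basis, extended ℝ-linearly
to `𝕃_ℝ`, is nef. -/
def IsNefBasis (S : SmoothCompleteFan n r) {k : ℕ} (e : Module.Basis (Fin k) ℤ S.relLattice) :
    Prop :=
  ∀ a, ∃ f ∈ S.nefCone, ∀ (l : S.relLattice) (l' : S.relSpace),
    (∀ i, (l' : Fin r → ℝ) i = ((l : Fin r → ℤ) i : ℝ)) → f l' = (e.repr l a : ℝ)

/-! ## The superpotential -/

/-- The coefficient `c_i(q) = ∏_a q_a ^ η_{ia}`, where `η(b̃_i) = ∑_a η_{ia} e_a`. -/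
noncomputable def coeff (S : SmoothCompleteFan n r) {k : ℕ}
    (e : Module.Basis (Fin k) ℤ S.relLattice) (η : (Fin r → ℤ) →ₗ[ℤ] S.relLattice)
    (q : Fin k → ℂ) (i : Fin r) : ℂ :=
  ∏ a, q a ^ (e.repr (η (Pi.single i 1)) a)

/-- The superpotential `W_q(Y) = ∑_i c_i(q) Y^{b_i}`, a Laurent polynomial on `(ℂ^*)ⁿ`. -/
noncomputable def superpotential (S : SmoothCompleteFan n r) {k : ℕ}
    (e : Module.Basis (Fin k) ℤ S.relLattice) (η : (Fin r → ℤ) →ₗ[ℤ] S.relLattice)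
    (q : Fin k → ℂ) (Y : Fin n → ℂ) : ℂ :=
  ∑ i, S.coeff e η q i * ∏ j, Y j ^ (S.ray i j)

end SmoothCompleteFan

/-- The region `U_{ε,ε'}` of the parameters `q ∈ (ℂ^*)ᵏ`. -/
def paramRegion (k : ℕ) (ε ε' : ℝ) : Set (Fin k → ℂ) :=
  {q | ∀ a, q a ≠ 0 ∧ ‖q a‖ < ε ∧ -ε' < (q a).arg ∧ (q a).arg < ε'}

/-! ## The torus, the skeleton and the Legendre transform -/

/-- `M_T = M_ℝ / M = (ℝ/ℤ)ⁿ`. -/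
abbrev Torus (n : ℕ) : Type := UnitAddTorus (Fin n)

/-- The covering map `M_ℝ → M_T`. -/
def torusMk {n : ℕ} (u : Fin n → ℝ) : Torus n := fun j => (u j : UnitAddCircle)

/-- The identification `M_T × M_ℝ ≅ (ℂ^*)ⁿ`, `(θ, ρ) ↦ (exp (ρ_j + 2πi θ_j))_j`. -/
noncomputable def polar {n : ℕ} (θ : Torus n) (ρ : Fin n → ℝ) : Fin n → ℂ :=
  fun j => Complex.exp (ρ j) * (AddCircle.toCircle (θ j) : ℂ)

/-- `Ψ_ℝ : M_ℝ → N_ℝ`, `ρ ↦ -dφ|_ρ`. -/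
noncomputable def legendre {n : ℕ} (φ : (Fin n → ℝ) → ℝ) (ρ : Fin n → ℝ) : Fin n → ℝ :=
  fun j => -fderiv ℝ φ ρ (Pi.single j 1)

namespace SmoothCompleteFan

variable {n r : ℕ}

/-- The polytope `P = {x | ⟨x, b_i⟩ ≤ 1 for all i} ⊆ M_ℝ`. -/
def polytope (S : SmoothCompleteFan n r) : Set (Fin n → ℝ) :=
  {x | ∀ i, x ⬝ᵥ intVec (S.ray i) ≤ 1}

/-- The conditions on the potential `φ_ℝ : M_ℝ → ℝ`: it is continuous, convex, homogeneous of
degree two, smooth with positive definite Hessian away from the origin (so that it is a Kähler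
potential), and it attains its minimum over every positive dimensional face `F` of `P` at a point
of the relative interior of `F`. -/
structure IsPotential (S : SmoothCompleteFan n r) (φ : (Fin n → ℝ) → ℝ) : Prop where
  continuous : Continuous φ
  convex : ConvexOn ℝ Set.univ φ
  homogeneous : ∀ (t : ℝ) (x : Fin n → ℝ), 0 < t → φ (t • x) = t ^ 2 * φ x
  smooth : ContDiffOn ℝ ∞ φ {0}ᶜ
  hessian_pos : ∀ x, x ≠ 0 → ∀ v, v ≠ 0 → 0 < fderiv ℝ (fderiv ℝ φ) x v v
  adapted : ∀ F : Set (Fin n → ℝ), IsExposed ℝ S.polytope F → F.Nontrivial →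
    ∃ x ∈ intrinsicInterior ℝ F, IsMinOn φ F x

/-- `Λ_σ = (σ^⊥ / M) × (-σ)` in `T^*M_T = M_T × N_ℝ`. -/
def skeletonPiece (S : SmoothCompleteFan n r) (s : Finset (Fin r)) :
    Set (Torus n × (Fin n → ℝ)) :=
  {y | (∃ u : Fin n → ℝ, (∀ v ∈ S.cone s, u ⬝ᵥ v = 0) ∧ y.1 = torusMk u) ∧ -y.2 ∈ S.cone s}

/-- The conical Lagrangian (FLTZ skeleton) `Λ = ⋃_σ Λ_σ`. -/
def skeleton (S : SmoothCompleteFan n r) : Set (Torus n × (Fin n → ℝ)) :=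
  ⋃ s ∈ S.cones, S.skeletonPiece s

/-- `V` is a conical neighbourhood of `Λ` minus the zero section inside `T^*M_T` minus the zero
section. -/
def IsConicalNhd (S : SmoothCompleteFan n r) (V : Set (Torus n × (Fin n → ℝ))) : Prop :=
  IsOpen V ∧ (∀ y ∈ V, y.2 ≠ 0) ∧ (∀ y ∈ V, ∀ t : ℝ, 0 < t → (y.1, t • y.2) ∈ V) ∧
    ∀ y ∈ S.skeleton, y.2 ≠ 0 → y ∈ V

end SmoothCompleteFan

/-! ## Sheaves on the torus, singular support and wrapped sheaves -/

/-- Sheaves of ℂ-vector spaces on `M_T`. -/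
abbrev TorusSheaf (n : ℕ) : Type 1 :=
  Sheaf (Opens.grothendieckTopology (Torus n)) (ModuleCat.{0} ℂ)

noncomputable instance torusSheafHasDerivedCategory (n : ℕ) :
    HasDerivedCategory.{1} (TorusSheaf n) := HasDerivedCategory.standard _

/-- The (unbounded) derived category `Sh^⋄(M_T)` of sheaves of ℂ-vector spaces on `M_T`. -/
abbrev TorusD (n : ℕ) : Type 1 := DerivedCategory (TorusSheaf n)

/-- `U ↦ j_! ℂ_U`: the sheaf associated with the free presheaf on `U`. -/
noncomputable def constOpen (n : ℕ) : Opens (Torus n) ⥤ TorusSheaf n :=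
  yoneda ⋙ (Functor.whiskeringRight _ _ _).obj (ModuleCat.free ℂ) ⋙ presheafToSheaf _ _

/-- `U ↦ U ∩ O`. -/
def interFunctor {n : ℕ} (O : Opens (Torus n)) : Opens (Torus n) ⥤ Opens (Torus n) :=
  (show Monotone (fun U : Opens (Torus n) => U ⊓ O) from fun _ _ h => inf_le_inf_right O h).functor

/-- The inclusions `U ∩ O ⊆ U`. -/
def interIncl {n : ℕ} (O : Opens (Torus n)) : interFunctor O ⟶ 𝟭 _ where
  app U := homOfLE (inf_le_left (a := U) (b := O))

/-- `U ↦ ℂ_{U \ O} = coker (ℂ_{U ∩ O} → ℂ_U)`. -/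
noncomputable def constLocClosed {n : ℕ} (O : Opens (Torus n)) : Opens (Torus n) ⥤ TorusSheaf n :=
  cokernel (Functor.whiskerRight (interIncl O) (constOpen n))

/-- The presheaf of local cohomology groups with supports in the complement `Z` of `O`,
`U ↦ H^k_Z(U; F) = Hom(ℂ_{U ∩ Z}, F[k])`. -/
noncomputable def localCoh {n : ℕ} (O : Opens (Torus n)) (F : TorusD n) (k : ℤ) :
    (Opens (Torus n))ᵒᵖ ⥤ ModuleCat.{1} ℂ :=
  (constLocClosed O ⋙ DerivedCategory.singleFunctor (TorusSheaf n) 0).op ⋙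
    (linearYoneda ℂ (TorusD n)).obj ((shiftFunctor (TorusD n) k).obj F)

/-- The stalk `H^k (RΓ_Z F)_x`, where `Z` is the complement of `O`. -/
noncomputable def localCohStalk {n : ℕ} (O : Opens (Torus n)) (F : TorusD n) (k : ℤ)
    (x : Torus n) : ModuleCat.{1} ℂ :=
  colimit ((OpenNhds.inclusion (X := TopCat.of (Torus n)) x).op ⋙ localCoh O F k)

/-- The map `torusMk` is open. -/
theorem isOpenMap_torusMk (n : ℕ) : IsOpenMap (torusMk (n := n)) := by
  exact IsOpenMap.piMap (f := fun (_ : Fin n) (t : ℝ) => (t : UnitAddCircle))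
    (fun _ => QuotientAddGroup.isOpenMap_coe) (by simp)

/-- For a function `ψ` near the origin of `ℝⁿ`, transported to a neighbourhood of `x` in the torus
by `v ↦ x + v`, the open region `{ψ < 0}`. -/
def negRegion {n : ℕ} (x : Torus n) (ψ : C(Fin n → ℝ, ℝ)) : Opens (Torus n) where
  carrier := (fun v => x + torusMk v) '' {v | v ∈ Metric.ball 0 (1 / 2) ∧ ψ v < 0}
  is_open' := by
    have h : IsOpenMap (fun v : Fin n → ℝ => x + torusMk v) :=
      (Homeomorph.addLeft x).isOpenMap.comp (isOpenMap_torusMk n)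
    exact h _ (Metric.isOpen_ball.inter (isOpen_lt ψ.continuous continuous_const))

/-- The singular support of `F`: a point `(x, ξ)` lies outside it iff it has a neighbourhood `U`
such that `(RΓ_{ψ ≥ 0} F)_{x'} = 0` for all `(x', ξ') ∈ U` and all functions `ψ` of class `C¹` near
`x'` with `ψ(x') = 0` and `dψ(x') = ξ'`. -/
def singularSupport {n : ℕ} (F : TorusD n) : Set (Torus n × (Fin n → ℝ)) :=
  {y | ¬ ∃ U : Set (Torus n × (Fin n → ℝ)), IsOpen U ∧ y ∈ U ∧
    ∀ y' ∈ U, ∀ ψ : C(Fin n → ℝ, ℝ), ContDiff ℝ 1 ψ → ψ 0 = 0 →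
      (∀ w, fderiv ℝ ψ 0 w = y'.2 ⬝ᵥ w) →
      ∀ k : ℤ, Subsingleton (localCohStalk (negRegion y'.1 ψ) F k y'.1)}

/-- An object `X` of a category with coproducts and additive `Hom`s is compact if every morphism
from `X` to a coproduct is a finite sum of morphisms to the summands. -/
def IsCompactObj {C : Type 1} [Category.{1} C] [Preadditive C] (X : C) : Prop :=
  ∀ (ι : Type) (G : ι → C) (c : Cofan G), Nonempty (IsColimit c) → ∀ f : X ⟶ c.pt,
    ∃ (s : Finset ι) (g : ∀ i, X ⟶ G i), f = ∑ i ∈ s, g i ≫ c.inj i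

namespace SmoothCompleteFan

variable {n r : ℕ}

/-- `Sh^⋄_Λ(M_T)`: the objects with singular support in `Λ`. -/
def skeletonSheaves (S : SmoothCompleteFan n r) : ObjectProperty (TorusD n) :=
  fun F => singularSupport F ⊆ S.skeleton

/-- `Sh^w_Λ(M_T)`: the compact objects of `Sh^⋄_Λ(M_T)`. -/
def IsWrapped (S : SmoothCompleteFan n r) (F : S.skeletonSheaves.FullSubcategory) : Prop :=
  IsCompactObj F

end SmoothCompleteFan

/-! ## Characteristic cycles -/

/-- The function `v ↦ ⟨ξ, v⟩ + |v|²`. At a point `(x, ξ)` where `Λ` coincides locally with the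
conormal bundle of `x + L`, `L` a linear subspace, its differential at the origin is `ξ`, its graph
is transverse to `Λ`, and its restriction to `L` has a nondegenerate minimum at the origin. -/
def testFunction {n : ℕ} (ξ : Fin n → ℝ) : C(Fin n → ℝ, ℝ) where
  toFun v := ξ ⬝ᵥ v + v ⬝ᵥ v
  continuous_toFun := by fun_prop

/-- The Euler characteristic of the microlocal stalk `(RΓ_{f ≥ 0} F)_x` of `F` at `y = (x, ξ)`,
with `f` the test function above. -/
noncomputable def microlocalEuler {n : ℕ} (F : TorusD n) (y : Torus n × (Fin n → ℝ)) : ℤ :=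
  ∑ᶠ k : ℤ, (k.negOnePow : ℤ) *
    (Module.finrank ℂ (localCohStalk (negRegion y.1 (testFunction y.2)) F k y.1) : ℤ)

namespace SmoothCompleteFan

variable {n r : ℕ}

/-- The smooth locus of `Λ`: the points that lie in exactly one of the `Λ_σ`. -/
def smoothLocus (S : SmoothCompleteFan n r) : Set (Torus n × (Fin n → ℝ)) :=
  {y | ∃! s, s ∈ S.cones ∧ y ∈ S.skeletonPiece s}

open Classical in
/-- The multiplicity function of the characteristic cycle `CC(F) = ∑_C m_C [C]`, the sum being over
the connected components `C` of the smooth locus of `Λ`: its value at a point of `C` is `m_C`, the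
Euler characteristic of the microlocal stalk at a point of `C` (by the theory of microlocal sheaves
it does not depend on this point); off the smooth locus it is `0`. -/
noncomputable def ccMultiplicity (S : SmoothCompleteFan n r) (F : TorusD n)
    (y : Torus n × (Fin n → ℝ)) : ℤ :=
  if h : y ∈ S.smoothLocus then
    microlocalEuler F (connectedComponentIn_nonempty_iff.mpr h).some
  else 0

/-! ## Oscillatory integrals over characteristic cycles -/

/-- `c : Fin n → Fin r` enumerates the rays of an `n`-dimensional cone that has `σ` as a face. -/
def IsFrame (S : SmoothCompleteFan n r) (s : Finset (Fin r)) (c : Fin n → Fin r) : Prop :=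
  Function.Injective c ∧ Finset.univ.image c ∈ S.cones ∧ s ⊆ Finset.univ.image c

/-- The basis of `M` dual to the basis `(b_{c j})_j` of `N`. -/
noncomputable def dualFrame (S : SmoothCompleteFan n r) (c : Fin n → Fin r) (j : Fin n) :
    Fin n → ℝ :=
  fun l => (Matrix.of fun i => intVec (S.ray (c i)))⁻¹ l j

/-- A chart of `Λ_σ`: the real coordinates `x_j` with `b_{c j} ∈ σ` parametrize `-σ` ... -/
noncomputable def chartMomentum (S : SmoothCompleteFan n r) (s : Finset (Fin r))
    (c : Fin n → Fin r) (x : Fin n → ℝ) : Fin n → ℝ :=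
  -∑ j, if c j ∈ s then x j • intVec (S.ray (c j)) else 0

/-- ... and the coordinates `x_j` with `b_{c j} ∉ σ` parametrize `σ^⊥`, the cover of `σ^⊥/M`. -/
noncomputable def chartAngle (S : SmoothCompleteFan n r) (s : Finset (Fin r))
    (c : Fin n → Fin r) (x : Fin n → ℝ) : Fin n → ℝ :=
  ∑ j, if c j ∈ s then 0 else x j • S.dualFrame c j

/-- The domain of the chart: it is mapped bijectively onto `(σ^⊥/M) × (-σ°)`, with `σ°` the relative
interior of `σ`. -/
def chartDomain (s : Finset (Fin r)) (c : Fin n → Fin r) : Set (Fin n → ℝ) :=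
  {x | ∀ j, (c j ∈ s → 0 < x j) ∧ (c j ∉ s → 0 ≤ x j ∧ x j < 1)}

/-- The chart of `Ψ⁻¹(Λ_σ) ⊆ (ℂ^*)ⁿ` in the logarithmic coordinates `log Y = ρ + 2πiθ`. -/
noncomputable def chartLog (S : SmoothCompleteFan n r) (φ : (Fin n → ℝ) → ℝ) (s : Finset (Fin r))
    (c : Fin n → Fin r) (x : Fin n → ℝ) : Fin n → ℂ :=
  fun l => (Function.invFun (legendre φ) (S.chartMomentum s c x) l : ℂ) +
    2 * Real.pi * Complex.I * (S.chartAngle s c x l : ℂ)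

/-- The density of the pullback of `Ω = dY_1 ⋯ dY_n / (Y_1 ⋯ Y_n) = dlog Y_1 ⋯ dlog Y_n` under the
chart, with respect to Lebesgue measure `dx_1 ⋯ dx_n`. -/
noncomputable def omegaDensity (S : SmoothCompleteFan n r) (φ : (Fin n → ℝ) → ℝ)
    (s : Finset (Fin r)) (c : Fin n → Fin r) (x : Fin n → ℝ) : ℂ :=
  Matrix.det (Matrix.of fun l k : Fin n =>
    fderiv ℝ (S.chartLog φ s c) x (Pi.single k 1) l)

/-- The oscillatory integral `∫_{Ψ⁻¹(CC(F))} e^{-W/z} Ω` converges (absolutely): the form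
`e^{-W/z} Ω`, weighted with the multiplicities of `CC(F)`, is integrable over the preimage under
`Ψ` of every piece `Λ_σ` of `Λ`. (Orientations only affect the sign of the integrand.) -/
def OscillatoryIntegralConverges (S : SmoothCompleteFan n r) (φ : (Fin n → ℝ) → ℝ)
    (W : (Fin n → ℂ) → ℂ) (z : ℂ) (F : TorusD n) : Prop :=
  ∀ s ∈ S.cones, ∀ c, S.IsFrame s c →
    IntegrableOn (fun x =>
      (S.ccMultiplicity F (torusMk (S.chartAngle s c x), S.chartMomentum s c x) : ℂ) *
        (Complex.exp (-W (fun l => Complex.exp (S.chartLog φ s c x l)) / z) *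
          S.omegaDensity φ s c x)) (chartDomain s c) volume

end SmoothCompleteFan

/-! The potential is a smoothing of the square of the gauge `height` of `P`, that is of h(x) = max_i
⟨x, b_i⟩: an ℓᵖ-norm of smoothed positive parts of the pairings, squared, plus δ|x|². On h = 1 and
for p large, its differential is governed by the rays whose pairing with x is almost 1. So φ
decreases at a definite rate from x towards any y in `P` that stays away from a facet nearly
containing x (`exists_potential_fderiv_le`). A single distance γ serves for all faces, as there are
finitely many (`exists_polytope_gap`).

This estimate is used twice. A minimum of φ over a face F cannot lie on a facet that does not
contain F, since φ would decrease towards a relatively interior point of F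
(`exists_isMinOn_intrinsicInterior`). Moreover, the Fano condition makes each cone σ the exact set
of facets through some u in `P`, and u maximises every covector of σ over `P`. If dφ(x) is nearly in
σ, then φ cannot decrease fast towards u, so all rays with nearly maximal pairing with x belong to σ
(`exists_isPotential`).

Near the skeleton the characters Y^{b_i}/|Y^{b_i}| with b_i in σ are close to 1, and so are the
phases of the coefficients once the arguments of q are small. Hence the terms of W of nearly maximal
modulus are almost positive, and the others are smaller by a factor exp(-ηh). After multiplication
by any unit ζ with Re ζ ≥ sin ε, the real part of Wζ is at least h(ρ) - C (`exists_growth`).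

Letting ζ vary confines arg W, which is (i). For (ii) take ζ = |z|/z: the integrand then decays
exponentially in h, hence in the momentum. Strong convexity makes the inverse Legendre map
Lipschitz, so the density of Ω in a chart is bounded. The sheaf enters only through the
multiplicities, which are constant on components of the smooth locus and so take finitely many
values almost everywhere on a chart (`IsFrame.integrableOn_ccMultiplicity_mul`). -/

/-! ### Dot products and the sup norm -/

theorem LinearMap.exists_eq_dotProduct {n : ℕ} (f : (Fin n → ℝ) →ₗ[ℝ] ℝ) :
    ∃ u : Fin n → ℝ, ∀ v, f v = u ⬝ᵥ v := by
  refine ⟨fun j => f (Pi.single j 1), fun v => ?_⟩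
  rw [LinearMap.pi_apply_eq_sum_univ f v]
  refine Finset.sum_congr rfl fun j _ => ?_
  rw [smul_eq_mul, mul_comm]
  congr 2
  ext k
  simp [Pi.single_apply, eq_comm]

theorem abs_dotProduct_le {n : ℕ} (u v : Fin n → ℝ) : |u ⬝ᵥ v| ≤ n * ‖u‖ * ‖v‖ := by
  calc |u ⬝ᵥ v| ≤ ∑ i, |u i * v i| := Finset.abs_sum_le_sum_abs _ _
    _ ≤ ∑ _i : Fin n, ‖u‖ * ‖v‖ := Finset.sum_le_sum fun i _ => by
        rw [abs_mul]
        exact mul_le_mul (norm_le_pi_norm u i) (norm_le_pi_norm v i) (abs_nonneg _) (norm_nonneg _)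
    _ = _ := by simp [mul_assoc]

theorem sq_norm_le_dotProduct {n : ℕ} (v : Fin n → ℝ) : ‖v‖ ^ 2 ≤ v ⬝ᵥ v := by
  have h0 : 0 ≤ v ⬝ᵥ v := Finset.sum_nonneg fun i _ => mul_self_nonneg _
  have : ‖v‖ ≤ √(v ⬝ᵥ v) := by
    refine (pi_norm_le_iff_of_nonneg (Real.sqrt_nonneg _)).2 fun i => ?_
    refine Real.le_sqrt_of_sq_le ?_
    rw [Real.norm_eq_abs, sq_abs, sq]
    exact Finset.single_le_sum (f := fun i => v i * v i) (fun i _ => mul_self_nonneg _)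
      (Finset.mem_univ i)
  calc ‖v‖ ^ 2 ≤ √(v ⬝ᵥ v) ^ 2 := by gcongr
    _ = _ := Real.sq_sqrt h0

theorem dotProduct_self_pos_of_ne {n : ℕ} {v : Fin n → ℝ} (hv : v ≠ 0) : 0 < v ⬝ᵥ v :=
  lt_of_lt_of_le (by have := norm_pos_iff.2 hv; positivity) (sq_norm_le_dotProduct v)

theorem continuous_dotProduct_const {n : ℕ} (b : Fin n → ℝ) :
    Continuous fun x : Fin n → ℝ => x ⬝ᵥ b := by
  unfold dotProduct
  fun_prop

/-- This is how the Fano condition is exploited: room to subtract a small multiple of another class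
is what yields strict inequalities at the vertices of the polytope. -/
theorem exists_pos_sub_smul_mem_of_mem_interior {E : Type*} [NormedAddCommGroup E]
    [NormedSpace ℝ E] {A : Set E} {f : E} (hf : f ∈ interior A) (g : E) :
    ∃ t : ℝ, 0 < t ∧ f - t • g ∈ A := by
  have hlim : Filter.Tendsto (fun t : ℝ => f - t • g) (nhdsWithin 0 (Set.Ioi 0)) (nhds f) := by
    have : Continuous fun t : ℝ => f - t • g := by fun_prop
    simpa using (this.tendsto 0).mono_left (nhdsWithin_le_nhds (s := Set.Ioi 0))
  obtain ⟨t, ht, ht0⟩ := ((hlim.eventually (mem_interior_iff_mem_nhds.1 hf)).and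
    self_mem_nhdsWithin).exists
  exact ⟨t, ht0, ht⟩

/-! ### The gauge of the polytope -/

namespace SmoothCompleteFan

variable {n r : ℕ} (S : SmoothCompleteFan n r)

theorem exists_dotProduct_eq {s : Finset (Fin r)} (hs : s ∈ S.cones) (w : Fin r → ℝ) :
    ∃ v : Fin n → ℝ, ∀ i ∈ s, v ⬝ᵥ intVec (S.ray i) = w i := by
  obtain ⟨g, hg⟩ := LinearMap.exists_leftInverse_of_injective _
    (LinearMap.ker_eq_bot.2 (S.simplicial s hs))
  obtain ⟨v, hv⟩ := LinearMap.exists_eq_dotProduct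
    ((Finsupp.linearCombination ℝ fun i : s => w i).comp g)
  refine ⟨v, fun i hi => ?_⟩
  have h1 := LinearMap.congr_fun hg (Finsupp.single ⟨i, hi⟩ 1)
  simp only [LinearMap.comp_apply, Finsupp.linearCombination_single, one_smul,
    LinearMap.id_apply] at h1
  rw [← hv, LinearMap.comp_apply, h1]
  simp

theorem dotProduct_sum_smul_ray (x : Fin n → ℝ) (c : Fin r → ℝ) (s : Finset (Fin r)) :
    x ⬝ᵥ ∑ i ∈ s, c i • intVec (S.ray i) = ∑ i ∈ s, c i * (x ⬝ᵥ intVec (S.ray i)) := by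
  simp [dotProduct_sum, dotProduct_smul]

/-- By completeness x itself is a nonnegative combination of rays, and ⟨x, x⟩ > 0. -/
theorem exists_dotProduct_ray_pos {x : Fin n → ℝ} (hx : x ≠ 0) :
    ∃ i, 0 < x ⬝ᵥ intVec (S.ray i) := by
  by_contra! h
  obtain ⟨s, -, c, hc, hxc⟩ := S.complete x
  have h1 : 0 < x ⬝ᵥ x := dotProduct_self_pos_of_ne hx
  nth_rw 2 [hxc] at h1
  rw [S.dotProduct_sum_smul_ray] at h1
  exact absurd h1 (not_lt.2 (Finset.sum_nonpos fun i _ => mul_nonpos_of_nonneg_of_nonpos (hc i) (h i)))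

/-- The support function `x ↦ max_i ⟨x, b_i⟩`, the gauge of the polytope. -/
noncomputable def height (x : Fin n → ℝ) : ℝ := ⨆ i, x ⬝ᵥ intVec (S.ray i)

theorem le_height (x : Fin n → ℝ) (i : Fin r) : x ⬝ᵥ intVec (S.ray i) ≤ S.height x :=
  le_ciSup (Set.finite_range fun i => x ⬝ᵥ intVec (S.ray i)).bddAbove i

theorem height_pos {x : Fin n → ℝ} (hx : x ≠ 0) : 0 < S.height x := by
  obtain ⟨i, hi⟩ := S.exists_dotProduct_ray_pos hx
  exact hi.trans_le (S.le_height x i)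

theorem exists_eq_height {x : Fin n → ℝ} (hx : x ≠ 0) :
    ∃ i, x ⬝ᵥ intVec (S.ray i) = S.height x := by
  obtain ⟨i, hi⟩ := S.exists_dotProduct_ray_pos hx
  have : Nonempty (Fin r) := ⟨i⟩
  exact exists_eq_ciSup_of_finite

theorem height_smul {t : ℝ} (ht : 0 ≤ t) (x : Fin n → ℝ) : S.height (t • x) = t * S.height x := by
  simp only [height, smul_dotProduct, smul_eq_mul]
  rw [Real.mul_iSup_of_nonneg ht]

theorem mem_polytope_of_height_le {x : Fin n → ℝ} (h : S.height x ≤ 1) : x ∈ S.polytope :=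
  fun i => (S.le_height x i).trans h

/-- The gauge is continuous and positive on the compact unit sphere. This bounds the polytope, and
later turns growth in the gauge into growth in the norm. -/
theorem exists_mul_norm_le_height : ∃ c > 0, ∀ x : Fin n → ℝ, c * ‖x‖ ≤ S.height x := by
  rcases isEmpty_or_nonempty (Fin r) with hr | hr
  · refine ⟨1, one_pos, fun x => ?_⟩
    have hx : x = 0 := by
      by_contra h
      exact hr.elim (S.exists_dotProduct_ray_pos h).choose
    simp [hx, height]
  have hcont : Continuous S.height := by
    have : S.height = fun x => Finset.univ.sup' Finset.univ_nonempty
        fun i => x ⬝ᵥ intVec (S.ray i) := by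
      ext x
      rw [Finset.sup'_univ_eq_ciSup]
      rfl
    rw [this]
    exact Continuous.finset_sup'_apply _ fun i _ => continuous_dotProduct_const _
  rcases (Metric.sphere (0 : Fin n → ℝ) 1).eq_empty_or_nonempty with hs | hs
  · refine ⟨1, one_pos, fun x => ?_⟩
    have hx : x = 0 := by
      by_contra h
      have : ‖x‖⁻¹ • x ∈ Metric.sphere (0 : Fin n → ℝ) 1 := by
        simp [norm_smul, inv_mul_cancel₀ (norm_ne_zero_iff.2 h)]
      simp [hs] at this
    simp [hx, height]
  obtain ⟨x₀, hx₀, hmin⟩ := (isCompact_sphere (0 : Fin n → ℝ) 1).exists_isMinOn hs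
    hcont.continuousOn
  refine ⟨S.height x₀, S.height_pos (by rintro rfl; simp at hx₀), fun x => ?_⟩
  rcases eq_or_ne x 0 with rfl | hx
  · simp [height]
  have hpos := norm_pos_iff.2 hx
  have h1 : ‖x‖⁻¹ • x ∈ Metric.sphere (0 : Fin n → ℝ) 1 := by
    simp [norm_smul, inv_mul_cancel₀ hpos.ne']
  have h2 := hmin h1
  simp only [Set.mem_ofPred_eq] at h2
  rw [S.height_smul (by positivity), ← div_eq_inv_mul, le_div_iff₀ hpos] at h2
  exact h2

theorem height_le_of_mem_polytope {x : Fin n → ℝ} (h : x ∈ S.polytope) : S.height x ≤ 1 :=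
  Real.iSup_le h zero_le_one

theorem exists_norm_le_of_mem_polytope : ∃ C > 0, ∀ x ∈ S.polytope, ‖x‖ ≤ C := by
  obtain ⟨c, hc, h⟩ := S.exists_mul_norm_le_height
  refine ⟨c⁻¹, by positivity, fun x hx => ?_⟩
  have := (h x).trans (S.height_le_of_mem_polytope hx)
  rwa [← one_div, le_div_iff₀ hc, mul_comm]

theorem isClosed_polytope : IsClosed S.polytope := by
  have : S.polytope = ⋂ i, {x | x ⬝ᵥ intVec (S.ray i) ≤ 1} := by
    ext x
    simp [polytope]
  rw [this]
  exact isClosed_iInter fun i => isClosed_le (continuous_dotProduct_const _) continuous_const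

theorem isCompact_polytope : IsCompact S.polytope := by
  obtain ⟨C, -, hC⟩ := S.exists_norm_le_of_mem_polytope
  exact Metric.isCompact_of_isClosed_isBounded S.isClosed_polytope
    (isBounded_iff_forall_norm_le.2 ⟨C, hC⟩)

/-! ### Cones of full dimension -/

theorem isClosed_cone {s : Finset (Fin r)} (hs : s ∈ S.cones) : IsClosed (S.cone s) := by
  let L : (s → ℝ) →ₗ[ℝ] (Fin n → ℝ) := Fintype.linearCombination ℝ fun i : s => intVec (S.ray i)
  have hL : LinearMap.ker L = ⊥ := by
    rw [LinearMap.ker_eq_bot]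
    exact (_root_.linearIndependent_iff_injective_fintypeLinearCombination).1 (S.simplicial s hs)
  have : S.cone s = L '' {c | ∀ i, 0 ≤ c i} := by
    ext v
    constructor
    · rintro ⟨c, hc, rfl⟩
      refine ⟨fun i => c i, fun i => hc i, ?_⟩
      simp only [L, Fintype.linearCombination_apply]
      exact Finset.sum_coe_sort s fun i => c i • intVec (S.ray i)
    · classical
      rintro ⟨c, hc, rfl⟩
      refine ⟨fun i => if h : i ∈ s then c ⟨i, h⟩ else 0, fun i => ?_, ?_⟩
      · dsimp only
        split_ifs
        exacts [hc _, le_rfl]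
      · simp only [L, Fintype.linearCombination_apply]
        rw [← Finset.sum_coe_sort s]
        exact Finset.sum_congr rfl fun i _ => by simp
  rw [this]
  refine (LinearMap.isClosedEmbedding_of_injective hL).isClosedMap _ ?_
  simp only [Set.ofPred_forall]
  exact isClosed_iInter fun i => isClosed_le continuous_const (continuous_apply i)

theorem cone_subset_span (s : Finset (Fin r)) :
    S.cone s ⊆ Submodule.span ℝ (Set.range fun i : s => intVec (S.ray i)) := by
  rintro v ⟨c, -, rfl⟩
  exact Submodule.sum_mem _ fun i hi => Submodule.smul_mem _ _ (Submodule.subset_span ⟨⟨i, hi⟩, rfl⟩)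

/-- The cones of smaller dimension lie in proper subspaces, so their union is null and its
complement is dense. That complement lies in the union of the full-dimensional cones, which is
closed, hence everything. -/
theorem exists_mem_cone_card_eq (v : Fin n → ℝ) : ∃ s ∈ S.cones, s.card = n ∧ v ∈ S.cone s := by
  classical
  let U : Set (Fin n → ℝ) := ⋃ s ∈ {s ∈ S.cones | s.card = n}, S.cone s
  let Z : Set (Fin n → ℝ) := ⋃ s ∈ {s ∈ S.cones | s.card ≠ n}, S.cone s
  have hU : IsClosed U := (Set.toFinite _).isClosed_biUnion fun s hs => S.isClosed_cone hs.1
  have hZ : volume Z = 0 := by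
    refine (measure_biUnion_null_iff (Set.to_countable _)).2 fun s hs => ?_
    refine measure_mono_null (S.cone_subset_span s) (Measure.addHaar_submodule _ _ fun htop => ?_)
    have h1 := finrank_span_eq_card (S.simplicial s hs.1)
    rw [htop, finrank_top] at h1
    simp at h1
    exact hs.2 h1.symm
  have hd : Dense Zᶜ := by
    have : Z =ᵐ[volume] (∅ : Set (Fin n → ℝ)) := ae_eq_empty.2 hZ
    exact Measure.dense_of_ae (μ := volume) (measure_eq_zero_iff_ae_notMem.1 hZ)
  have hsub : Zᶜ ⊆ U := by
    intro w hw
    obtain ⟨s, hs, hws⟩ := S.complete w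
    by_cases hcard : s.card = n
    · exact Set.mem_biUnion (show s ∈ {s ∈ S.cones | s.card = n} from ⟨hs, hcard⟩) hws
    · exact absurd (Set.mem_biUnion (show s ∈ {s ∈ S.cones | s.card ≠ n} from ⟨hs, hcard⟩) hws) hw
  have : v ∈ U := by
    have := closure_mono hsub (hd v)
    rwa [hU.closure_eq] at this
  simpa [U, and_assoc] using this

/-- A common point lies in the cone of s ∩ t. A functional dual to a ray of s outside t would vanish
there, yet it is positive on the relative interior of s. -/
theorem subset_of_sum_mem_cone {s t : Finset (Fin r)} (hs : s ∈ S.cones) (ht : t ∈ S.cones)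
    {c : Fin r → ℝ} (hc : ∀ i ∈ s, 0 < c i) (h : ∑ i ∈ s, c i • intVec (S.ray i) ∈ S.cone t) :
    s ⊆ t := by
  classical
  have hmem : ∑ i ∈ s, c i • intVec (S.ray i) ∈ S.cone s := by
    refine ⟨fun i => if i ∈ s then c i else 0, fun i => ?_, Finset.sum_congr rfl fun i hi => by
      simp [hi]⟩
    dsimp only
    split_ifs with hi
    exacts [(hc i hi).le, le_rfl]
  obtain ⟨d, -, hd⟩ : ∑ i ∈ s, c i • intVec (S.ray i) ∈ coneOf S.ray (s ∩ t) := by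
    rw [← S.inter_eq s hs t ht]
    exact ⟨hmem, h⟩
  intro i hi
  by_contra hit
  obtain ⟨v, hv⟩ := S.exists_dotProduct_eq hs (Pi.single i 1)
  have h1 := congrArg (fun w => v ⬝ᵥ w) hd
  simp only [S.dotProduct_sum_smul_ray] at h1
  rw [Finset.sum_congr rfl fun j hj => by rw [hv j hj],
    Finset.sum_congr (s₁ := s ∩ t) rfl fun j hj => by rw [hv j (Finset.mem_inter.1 hj).1]] at h1
  simp [Pi.single_apply, hi, hit] at h1
  exact (hc i hi).ne' h1

theorem exists_superset_card_eq {s : Finset (Fin r)} (hs : s ∈ S.cones) :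
    ∃ t ∈ S.cones, t.card = n ∧ s ⊆ t := by
  obtain ⟨t, ht, hcard, hmem⟩ := S.exists_mem_cone_card_eq (∑ i ∈ s, (1 : ℝ) • intVec (S.ray i))
  exact ⟨t, ht, hcard, S.subset_of_sum_mem_cone hs ht (c := fun _ => 1) (fun _ _ => one_pos) hmem⟩

/-! ### Vertices and faces of the polytope of a Fano fan -/

/-- Subtracting from D_1 + ⋯ + D_r a small multiple of the sum of the D_i off σ leaves a class in
Nef_σ. Comparing coefficients gives numbers d_i that annihilate all relations between the rays,
hence are pairings ⟨u, b_i⟩; they equal 1 on σ and drop by at least t elsewhere. -/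
theorem exists_vertex (hF : S.IsFano) {s : Finset (Fin r)} (hs : s ∈ S.cones) (hcard : s.card = n) :
    ∃ u : Fin n → ℝ, (∀ i ∈ s, u ⬝ᵥ intVec (S.ray i) = 1) ∧
      ∀ i ∉ s, u ⬝ᵥ intVec (S.ray i) < 1 := by
  classical
  let g : StrongDual ℝ S.relSpace := ∑ i, (if i ∈ s then (0 : ℝ) else 1) • S.divisorClass i
  obtain ⟨t, ht0, ht⟩ := exists_pos_sub_smul_mem_of_mem_interior hF g
  obtain ⟨c, hc, hcs, hEq⟩ := ht s hs hcard
  let d : Fin r → ℝ := fun i => 1 - t * (if i ∈ s then (0 : ℝ) else 1) - c i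
  let f : (Fin r → ℝ) →ₗ[ℝ] ℝ := Fintype.linearCombination ℝ d
  have hker : f ∈ (LinearMap.ker (Fintype.linearCombination ℝ
      fun i => intVec (S.ray i))).dualAnnihilator := by
    rw [Submodule.mem_dualAnnihilator]
    intro l hl
    have hval : ∀ a : Fin r → ℝ,
        (∑ i, a i • S.divisorClass i : StrongDual ℝ S.relSpace) ⟨l, hl⟩ = ∑ i, a i * l i := by
      intro a
      simp [divisorClass, sum_apply]
    have h1 := congrArg (fun F : StrongDual ℝ S.relSpace => F ⟨l, hl⟩) hEq
    have hone : ∑ i, S.divisorClass i = ∑ i, (1 : ℝ) • S.divisorClass i := by simp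
    simp only [sub_apply, smul_apply, hone, g, hval,
      smul_eq_mul] at h1
    simp only [f, Fintype.linearCombination_apply, d, smul_eq_mul]
    refine Eq.trans ?_ (sub_eq_zero.2 h1)
    rw [Finset.mul_sum, ← Finset.sum_sub_distrib, ← Finset.sum_sub_distrib]
    exact Finset.sum_congr rfl fun i _ => by ring
  -- A functional on ℝʳ that kills the relations factors through ℝʳ → N_ℝ.
  rw [← LinearMap.range_dualMap_eq_dualAnnihilator_ker] at hker
  obtain ⟨m, hm⟩ := hker
  obtain ⟨u, hu⟩ := LinearMap.exists_eq_dotProduct m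
  have key : ∀ i, u ⬝ᵥ intVec (S.ray i) = d i := fun i => by
    have := LinearMap.congr_fun hm (Pi.single i 1)
    simp [f, LinearMap.dualMap_apply, Fintype.linearCombination_apply_single] at this
    rw [← hu, this]
  refine ⟨u, fun i hi => ?_, fun i hi => ?_⟩
  · rw [key]; simp [d, hi, hcs i hi]
  · rw [key]
    have := hc i
    have h0 : 0 < t := ht0
    simp only [d, hi, if_false]
    linarith

/-- Start at the vertex of a maximal cone t ⊇ s and move slightly so that the pairings with t \ s
drop while those with s stay 1; strictness off t survives a small move. -/
theorem exists_mem_polytope_eq_one_iff (hF : S.IsFano) {s : Finset (Fin r)} (hs : s ∈ S.cones) :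
    ∃ u ∈ S.polytope, ∀ i, u ⬝ᵥ intVec (S.ray i) = 1 ↔ i ∈ s := by
  classical
  obtain ⟨t, ht, hcard, hst⟩ := S.exists_superset_card_eq hs
  obtain ⟨u, hu1, hu2⟩ := S.exists_vertex hF ht hcard
  obtain ⟨v, hv⟩ := S.exists_dotProduct_eq ht fun i => if i ∈ s then 0 else 1
  have hev : ∀ᶠ a : ℝ in nhdsWithin 0 (Set.Ioi 0), ∀ i ∈ tᶜ, (u - a • v) ⬝ᵥ intVec (S.ray i) < 1 := by
    rw [Filter.eventually_all_finset]
    intro i hi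
    have : Continuous fun a : ℝ => (u - a • v) ⬝ᵥ intVec (S.ray i) :=
      (continuous_dotProduct_const _).comp (by fun_prop)
    have h := (this.tendsto 0).mono_left (nhdsWithin_le_nhds (s := Set.Ioi 0))
    simp only [zero_smul, sub_zero] at h
    exact h.eventually (gt_mem_nhds (hu2 i (Finset.mem_compl.1 hi)))
  obtain ⟨a, ha, ha0⟩ := (hev.and self_mem_nhdsWithin).exists
  replace ha0 : 0 < a := ha0
  have key : ∀ i ∈ t, (u - a • v) ⬝ᵥ intVec (S.ray i) = if i ∈ s then 1 else 1 - a := fun i hi => by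
    rw [sub_dotProduct, smul_dotProduct, hu1 i hi, hv i hi]
    split_ifs <;> simp
  refine ⟨u - a • v, fun i => ?_, fun i => ?_⟩
  · by_cases hi : i ∈ t
    · rw [key i hi]; split_ifs <;> linarith
    · exact (ha i (Finset.mem_compl.2 hi)).le
  · by_cases hi : i ∈ t
    · rw [key i hi]
      split_ifs with h
      · simp [h]
      · simp [h]; exact ha0.ne'
    · have := ha i (Finset.mem_compl.2 hi)
      exact ⟨fun h => absurd h this.ne, fun h => absurd (hst h) hi⟩

end SmoothCompleteFan

/-! ### Strongly convex homogeneous functions and their Legendre map -/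

theorem ConvexOn.add_fderiv_le {E : Type*} [NormedAddCommGroup E] [NormedSpace ℝ E] {f : E → ℝ}
    (hf : ConvexOn ℝ Set.univ f) {x : E} (hd : DifferentiableAt ℝ f x) (v : E) :
    f x + fderiv ℝ f x v ≤ f (x + v) := by
  have h1 : ConvexOn ℝ Set.univ fun t : ℝ => f (AffineMap.lineMap x (x + v) t) :=
    hf.comp_affineMap (AffineMap.lineMap x (x + v))
  have h2 : HasDerivAt (fun t : ℝ => f (AffineMap.lineMap x (x + v) t)) (fderiv ℝ f x v) 0 := by
    have hl : HasDerivAt (fun t : ℝ => AffineMap.lineMap x (x + v) t) v (0 : ℝ) := by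
      have := AffineMap.hasDerivAt_lineMap (a := x) (b := x + v) (x := (0 : ℝ))
      simpa using this
    have hd' : HasFDerivAt f (fderiv ℝ f x) (AffineMap.lineMap x (x + v) (0 : ℝ)) := by
      simpa using hd.hasFDerivAt
    exact hd'.comp_hasDerivAt (0 : ℝ) hl
  have h3 := h1.le_slope_of_hasDerivAt (Set.mem_univ 0) (Set.mem_univ 1) one_pos h2
  simp [slope_def_field] at h3
  linarith

theorem hasFDerivAt_dotProduct_self {n : ℕ} (x : Fin n → ℝ) :
    ∃ L : (Fin n → ℝ) →L[ℝ] ℝ, HasFDerivAt (fun y : Fin n → ℝ => y ⬝ᵥ y) L x ∧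
      ∀ v, L v = 2 * (x ⬝ᵥ v) := by
  refine ⟨∑ i, (x i • ContinuousLinearMap.proj (R := ℝ) (φ := fun _ : Fin n => ℝ) i +
    x i • ContinuousLinearMap.proj (R := ℝ) (φ := fun _ : Fin n => ℝ) i), ?_, fun v => ?_⟩
  · refine HasFDerivAt.fun_sum fun i _ => ?_
    have h := (ContinuousLinearMap.proj (R := ℝ) (φ := fun _ : Fin n => ℝ) i).hasFDerivAt (x := x)
    exact h.mul h
  · simp only [sum_apply, add_apply, smul_apply, ContinuousLinearMap.proj_apply, smul_eq_mul,
      dotProduct, Finset.mul_sum]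
    exact Finset.sum_congr rfl fun i _ => by ring

theorem convexOn_dotProduct_self (n : ℕ) :
    ConvexOn ℝ Set.univ fun x : Fin n → ℝ => x ⬝ᵥ x := by
  refine ⟨convex_univ, fun x _ y _ a b ha hb hab => ?_⟩
  have h : 0 ≤ (x - y) ⬝ᵥ (x - y) := Finset.sum_nonneg fun i _ => mul_self_nonneg _
  simp only [add_dotProduct, dotProduct_add, smul_dotProduct, dotProduct_smul, sub_dotProduct,
    dotProduct_sub, smul_eq_mul, dotProduct_comm y x] at h ⊢
  obtain rfl : b = 1 - a := by linarith
  nlinarith [mul_nonneg (mul_nonneg ha hb) h]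

/-- A continuous function homogeneous of degree two, smooth away from the origin and strongly convex
with modulus `2 * δ`. -/
structure IsStronglyConvexQuadratic {n : ℕ} (δ : ℝ) (φ : (Fin n → ℝ) → ℝ) : Prop where
  pos : 0 < δ
  continuous : Continuous φ
  homogeneous : ∀ (t : ℝ) (x : Fin n → ℝ), 0 < t → φ (t • x) = t ^ 2 * φ x
  smooth : ContDiffOn ℝ ∞ φ {0}ᶜ
  convex_sub : ConvexOn ℝ Set.univ fun x => φ x - δ * (x ⬝ᵥ x)

theorem fderiv_apply_eq_neg_legendre {n : ℕ} (φ : (Fin n → ℝ) → ℝ) (x v : Fin n → ℝ) :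
    fderiv ℝ φ x v = -(legendre φ x ⬝ᵥ v) := by
  have h := LinearMap.pi_apply_eq_sum_univ (fderiv ℝ φ x : (Fin n → ℝ) →ₗ[ℝ] ℝ) v
  simp only [ContinuousLinearMap.coe_coe] at h
  rw [h, dotProduct, ← Finset.sum_neg_distrib]
  refine Finset.sum_congr rfl fun j _ => ?_
  have : (fun k => if j = k then (1 : ℝ) else 0) = Pi.single j 1 := by
    ext k
    simp [Pi.single_apply, eq_comm]
  rw [this, legendre, smul_eq_mul]
  ring

namespace IsStronglyConvexQuadratic

variable {n : ℕ} {δ : ℝ} {φ : (Fin n → ℝ) → ℝ}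

theorem map_zero (h : IsStronglyConvexQuadratic δ φ) : φ 0 = 0 := by
  have := h.homogeneous 2 0 two_pos
  rw [smul_zero] at this
  linarith

/-- Smoothness is only assumed off the origin, but homogeneity gives |φ(x)| ≤ C‖x‖² and hence a zero
derivative there. -/
theorem hasFDerivAt_zero (h : IsStronglyConvexQuadratic δ φ) :
    HasFDerivAt φ (0 : (Fin n → ℝ) →L[ℝ] ℝ) 0 := by
  obtain ⟨C, hC⟩ := (isCompact_closedBall (0 : Fin n → ℝ) 1).exists_bound_of_continuousOn
    h.continuous.continuousOn
  refine Asymptotics.IsBigO.hasFDerivAt (n := 2) ?_ one_lt_two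
  refine Asymptotics.IsBigO.of_bound C (Filter.Eventually.of_forall fun x => ?_)
  rcases eq_or_ne x 0 with rfl | hx
  · simp [h.map_zero]
  have hpos := norm_pos_iff.2 hx
  have h1 : φ x = ‖x‖ ^ 2 * φ (‖x‖⁻¹ • x) := by
    rw [← h.homogeneous _ _ hpos, smul_smul, mul_inv_cancel₀ hpos.ne', one_smul]
  have h2 := hC (‖x‖⁻¹ • x) (by simp [norm_smul, inv_mul_cancel₀ hpos.ne'])
  rw [h1, norm_mul, sub_zero, norm_pow, norm_norm, mul_comm]
  gcongr

theorem differentiable (h : IsStronglyConvexQuadratic δ φ) : Differentiable ℝ φ := by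
  intro x
  rcases eq_or_ne x 0 with rfl | hx
  · exact h.hasFDerivAt_zero.differentiableAt
  · exact (h.smooth.contDiffAt (isOpen_compl_singleton.mem_nhds hx)).differentiableAt (by simp)

theorem legendre_zero (h : IsStronglyConvexQuadratic δ φ) : legendre φ 0 = 0 := by
  ext j
  simp [legendre, h.hasFDerivAt_zero.fderiv]

theorem convex (h : IsStronglyConvexQuadratic δ φ) : ConvexOn ℝ Set.univ φ := by
  have := h.convex_sub.add ((convexOn_dotProduct_self n).smul h.pos.le)
  refine this.congr fun x _ => ?_
  simp

theorem le_apply_add (h : IsStronglyConvexQuadratic δ φ) (x v : Fin n → ℝ) :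
    φ x + fderiv ℝ φ x v + δ * (v ⬝ᵥ v) ≤ φ (x + v) := by
  obtain ⟨L, hL, hLv⟩ := hasFDerivAt_dotProduct_self x
  have hd := (h.differentiable x).hasFDerivAt.sub (hL.const_mul δ)
  have := h.convex_sub.add_fderiv_le hd.differentiableAt v
  have hfd : fderiv ℝ (fun x => φ x - δ * (x ⬝ᵥ x)) x = fderiv ℝ φ x - δ • L := hd.fderiv
  rw [hfd] at this
  simp only [sub_apply, smul_apply, hLv, smul_eq_mul, add_dotProduct, dotProduct_add,
    dotProduct_comm v x] at this
  linarith

theorem strong_monotone (h : IsStronglyConvexQuadratic δ φ) (x v : Fin n → ℝ) :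
    2 * δ * (v ⬝ᵥ v) ≤ fderiv ℝ φ (x + v) v - fderiv ℝ φ x v := by
  have h1 := h.le_apply_add x v
  have h2 := h.le_apply_add (x + v) (-v)
  simp only [map_neg, add_neg_cancel_right, neg_dotProduct, dotProduct_neg] at h2
  linarith

theorem fderiv_smul (h : IsStronglyConvexQuadratic δ φ) {t : ℝ} (ht : 0 < t) (x v : Fin n → ℝ) :
    fderiv ℝ φ (t • x) v = t * fderiv ℝ φ x v := by
  have h1 : HasFDerivAt (fun y => φ (t • y))
      ((fderiv ℝ φ (t • x)).comp (t • ContinuousLinearMap.id ℝ (Fin n → ℝ))) x :=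
    (h.differentiable (t • x)).hasFDerivAt.comp x ((hasFDerivAt_id x).const_smul t)
  have h2 : HasFDerivAt (fun y => φ (t • y)) (t ^ 2 • fderiv ℝ φ x) x := by
    simp only [fun y => h.homogeneous t y ht]
    exact (h.differentiable x).hasFDerivAt.const_mul _
  have h3 := congrArg (fun L : (Fin n → ℝ) →L[ℝ] ℝ => L v) (h1.unique h2)
  simp at h3
  have h4 : t * (fderiv ℝ φ (t • x) v - t * fderiv ℝ φ x v) = 0 := by linear_combination h3
  rcases mul_eq_zero.1 h4 with h5 | h5
  · exact absurd h5 ht.ne'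
  · linarith

theorem legendre_smul (h : IsStronglyConvexQuadratic δ φ) {t : ℝ} (ht : 0 < t) (x : Fin n → ℝ) :
    legendre φ (t • x) = t • legendre φ x := by
  ext j
  simp [legendre, h.fderiv_smul ht]

theorem hessian_pos (h : IsStronglyConvexQuadratic δ φ) {x v : Fin n → ℝ} (hx : x ≠ 0)
    (hv : v ≠ 0) : 0 < fderiv ℝ (fderiv ℝ φ) x v v := by
  have hd : DifferentiableAt ℝ (fderiv ℝ φ) x := by
    have h1 := h.smooth.contDiffAt (isOpen_compl_singleton.mem_nhds hx)
    exact (h1.fderiv_right (m := 1) (by norm_cast)).differentiableAt (by simp)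
  have hl : HasDerivAt (fun t : ℝ => x + t • v) v 0 := by
    simpa using ((hasDerivAt_id (0 : ℝ)).smul_const v).const_add x
  have hd' : HasFDerivAt (fderiv ℝ φ) (fderiv ℝ (fderiv ℝ φ) x) (x + (0 : ℝ) • v) := by
    simpa using hd.hasFDerivAt
  have h2 : HasDerivAt (fun t : ℝ => fderiv ℝ φ (x + t • v)) (fderiv ℝ (fderiv ℝ φ) x v) 0 :=
    hd'.comp_hasDerivAt (0 : ℝ) hl
  have h3 : HasDerivAt (fun t : ℝ => fderiv ℝ φ (x + t • v) v)
      (fderiv ℝ (fderiv ℝ φ) x v v) 0 := by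
    simpa using h2.clm_apply (hasDerivAt_const (0 : ℝ) v)
  have h4 := h3.tendsto_slope_zero_right
  -- Pass to the limit in the strong monotonicity of the gradient, divided by t².
  have h5 : 2 * δ * (v ⬝ᵥ v) ≤ fderiv ℝ (fderiv ℝ φ) x v v := by
    refine ge_of_tendsto h4 ?_
    filter_upwards [self_mem_nhdsWithin] with t ht
    replace ht : 0 < t := ht
    have h6 := h.strong_monotone x (t • v)
    simp only [map_smul, smul_dotProduct, dotProduct_smul, smul_eq_mul] at h6
    simp only [zero_add, zero_smul, add_zero, smul_eq_mul]
    rw [← div_eq_inv_mul, le_div_iff₀ ht]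
    nlinarith
  have := mul_pos h.pos (dotProduct_self_pos_of_ne hv)
  linarith

/-- Strong monotonicity of the gradient makes the inverse Legendre map Lipschitz, at the origin too;
injectivity and the bound on the density of Ω both come from this. -/
theorem norm_sub_le (h : IsStronglyConvexQuadratic δ φ) (x y : Fin n → ℝ) :
    ‖x - y‖ ≤ n / (2 * δ) * ‖legendre φ x - legendre φ y‖ := by
  have h1 := h.strong_monotone y (x - y)
  rw [add_sub_cancel, fderiv_apply_eq_neg_legendre, fderiv_apply_eq_neg_legendre] at h1
  have h2 := (abs_le.1 (abs_dotProduct_le (legendre φ x - legendre φ y) (x - y))).1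
  rw [sub_dotProduct] at h2
  have h3 := sq_norm_le_dotProduct (x - y)
  have hδ := h.pos
  rcases (norm_nonneg (x - y)).eq_or_lt with h0 | h0
  · rw [← h0]; positivity
  have h4 : 2 * δ * ‖x - y‖ ^ 2 ≤ n * ‖legendre φ x - legendre φ y‖ * ‖x - y‖ := by
    nlinarith
  rw [div_mul_eq_mul_div, le_div_iff₀ (by positivity)]
  refine le_of_mul_le_mul_right ?_ h0
  linarith

theorem legendre_injective (h : IsStronglyConvexQuadratic δ φ) :
    Function.Injective (legendre φ) := by
  intro x y hxy
  have := h.norm_sub_le x y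
  rw [hxy, sub_self, norm_zero, mul_zero] at this
  exact sub_eq_zero.1 (norm_le_zero_iff.1 this)

theorem le_apply (h : IsStronglyConvexQuadratic δ φ) (x : Fin n → ℝ) : δ * (x ⬝ᵥ x) ≤ φ x := by
  have := h.le_apply_add 0 x
  simpa [h.map_zero, h.hasFDerivAt_zero.fderiv] using this

/-- Strong convexity makes φ + ⟨·, ξ⟩ coercive, and at its minimum -dφ = ξ. -/
theorem legendre_surjective (h : IsStronglyConvexQuadratic δ φ) :
    Function.Surjective (legendre φ) := by
  intro ξ
  let f : (Fin n → ℝ) → ℝ := fun x => φ x + x ⬝ᵥ ξ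
  have hf : Continuous f := h.continuous.add (continuous_dotProduct_const ξ)
  have htend : Filter.Tendsto f (Filter.cocompact _) Filter.atTop := by
    have h1 : Filter.Tendsto (fun x : Fin n → ℝ => ‖x‖ * (δ * ‖x‖ - n * ‖ξ‖))
        (Filter.cocompact _) Filter.atTop := by
      have hn := tendsto_norm_cocompact_atTop (E := Fin n → ℝ)
      exact hn.atTop_mul_atTop₀
        (Filter.tendsto_atTop_add_const_right _ _ (hn.const_mul_atTop h.pos))
    refine Filter.tendsto_atTop_mono (fun x => ?_) h1
    have h2 := (abs_le.1 (abs_dotProduct_le x ξ)).1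
    have h3 := h.le_apply x
    have h4 := mul_le_mul_of_nonneg_left (sq_norm_le_dotProduct x) h.pos.le
    simp only [f]
    nlinarith
  obtain ⟨x, hx⟩ := hf.exists_forall_le htend
  refine ⟨x, ?_⟩
  obtain ⟨g, hg⟩ : ∃ g : (Fin n → ℝ) →L[ℝ] ℝ, ∀ v, g v = v ⬝ᵥ ξ :=
    ⟨LinearMap.toContinuousLinearMap
      { toFun := fun v => v ⬝ᵥ ξ, map_add' := fun a b => add_dotProduct a b ξ,
        map_smul' := fun a b => smul_dotProduct a b ξ }, fun v => rfl⟩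
  have hd : HasFDerivAt f (fderiv ℝ φ x + g) x := by
    refine (h.differentiable x).hasFDerivAt.add ?_
    have := g.hasFDerivAt (x := x)
    simpa only [← hg] using this
  have h0 : fderiv ℝ φ x + g = 0 := IsLocalMin.hasFDerivAt_eq_zero
    (Filter.Eventually.of_forall hx) hd
  ext j
  have := congrArg (fun L : (Fin n → ℝ) →L[ℝ] ℝ => L (Pi.single j 1)) h0
  simp [hg] at this
  simp only [legendre]
  linarith

/-- On unit vectors, dφ_x(v) ≤ φ(x + v) - φ(x), where φ ≥ 0 and φ is bounded on the ball of radius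
2; the general case follows by homogeneity. -/
theorem exists_norm_legendre_le (h : IsStronglyConvexQuadratic δ φ) :
    ∃ C > 0, ∀ x, ‖legendre φ x‖ ≤ C * ‖x‖ := by
  obtain ⟨C, hC⟩ := (isCompact_closedBall (0 : Fin n → ℝ) 2).exists_bound_of_continuousOn
    h.continuous.continuousOn
  have hC0 : 0 ≤ C := (norm_nonneg _).trans (hC 0 (by simp))
  have hnn : ∀ x, 0 ≤ φ x := fun x => (mul_nonneg h.pos.le
    (Finset.sum_nonneg fun i _ => mul_self_nonneg _)).trans (h.le_apply x)
  have hle : ∀ x v : Fin n → ℝ, ‖x‖ = 1 → ‖v‖ = 1 → fderiv ℝ φ x v ≤ C := by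
    intro x v hx hv
    have h1 := h.le_apply_add x v
    have h2 : ‖φ (x + v)‖ ≤ C := hC _ (by
      rw [mem_closedBall_zero_iff]
      linarith [norm_add_le x v])
    have h3 : 0 ≤ δ * (v ⬝ᵥ v) := mul_nonneg h.pos.le
      (Finset.sum_nonneg fun i _ => mul_self_nonneg _)
    linarith [hnn x, le_abs_self (φ (x + v)), Real.norm_eq_abs (φ (x + v))]
  refine ⟨C + 1, by positivity, fun x => ?_⟩
  rcases eq_or_ne x 0 with rfl | hx
  · simp [h.legendre_zero]
  have hpos := norm_pos_iff.2 hx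
  have hu : ‖‖x‖⁻¹ • x‖ = 1 := by simp [norm_smul, inv_mul_cancel₀ hpos.ne']
  have h1 : ‖legendre φ (‖x‖⁻¹ • x)‖ ≤ C := by
    refine (pi_norm_le_iff_of_nonneg hC0).2 fun j => ?_
    have h0 : ‖(Pi.single j 1 : Fin n → ℝ)‖ = 1 := by rw [Pi.norm_single, norm_one]
    have h2 := hle _ (Pi.single j 1) hu h0
    have h3 := hle _ (-Pi.single j 1) hu (by rw [norm_neg, h0])
    rw [map_neg] at h3
    rw [Real.norm_eq_abs, legendre, abs_neg, abs_le]
    constructor <;> linarith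
  rw [h.legendre_smul (by positivity), norm_smul, norm_inv, norm_norm, ← div_eq_inv_mul,
    div_le_iff₀ hpos] at h1
  linarith

end IsStronglyConvexQuadratic

/-! ### A smooth approximation of the positive part of a linear form -/

/-- The radius `√(⟨x, b⟩² + δ² |x|²)`. -/
noncomputable def smoothRadius {n : ℕ} (δ : ℝ) (b x : Fin n → ℝ) : ℝ :=
  √((x ⬝ᵥ b) ^ 2 + δ ^ 2 * (x ⬝ᵥ x))

/-- A smooth approximation, homogeneous of degree one, of the positive part of `⟨x, b⟩`. -/
noncomputable def smoothPart {n : ℕ} (δ : ℝ) (b x : Fin n → ℝ) : ℝ :=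
  (x ⬝ᵥ b + smoothRadius δ b x) / 2

section smoothPart

variable {n : ℕ} {δ : ℝ} (b x : Fin n → ℝ)

theorem dotProduct_self_nonneg_real : 0 ≤ x ⬝ᵥ x := Finset.sum_nonneg fun _ _ => mul_self_nonneg _

theorem abs_dotProduct_le_smoothRadius : |x ⬝ᵥ b| ≤ smoothRadius δ b x := by
  rw [← Real.sqrt_sq_eq_abs]
  exact Real.sqrt_le_sqrt (by have := dotProduct_self_nonneg_real x; nlinarith [sq_nonneg δ, mul_nonneg (sq_nonneg δ) this])

theorem smoothPart_nonneg : 0 ≤ smoothPart δ b x := by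
  have := (abs_le.1 (abs_dotProduct_le_smoothRadius (δ := δ) b x)).1
  unfold smoothPart
  linarith

theorem dotProduct_le_smoothPart : x ⬝ᵥ b ≤ smoothPart δ b x := by
  have := (abs_le.1 (abs_dotProduct_le_smoothRadius (δ := δ) b x)).2
  unfold smoothPart
  linarith

theorem smoothPart_le_smoothRadius : smoothPart δ b x ≤ smoothRadius δ b x := by
  have := (abs_le.1 (abs_dotProduct_le_smoothRadius (δ := δ) b x)).2
  unfold smoothPart
  linarith

variable {x} in
theorem smoothRadius_pos (hδ : 0 < δ) (hx : x ≠ 0) : 0 < smoothRadius δ b x := by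
  have := dotProduct_self_pos_of_ne hx
  exact Real.sqrt_pos.2 (by positivity)

variable {x} in
theorem smoothPart_pos (hδ : 0 < δ) (hx : x ≠ 0) : 0 < smoothPart δ b x := by
  have h1 : |x ⬝ᵥ b| < smoothRadius δ b x := by
    rw [← Real.sqrt_sq_eq_abs]
    have := dotProduct_self_pos_of_ne hx
    exact Real.sqrt_lt_sqrt (sq_nonneg _) (by have : 0 < δ ^ 2 * (x ⬝ᵥ x) := by positivity
                                              linarith)
  have := (abs_lt.1 h1).1
  unfold smoothPart
  linarith

theorem smoothPart_le (hδ : 0 < δ) :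
    smoothPart δ b x ≤ max (x ⬝ᵥ b) 0 + δ * √(x ⬝ᵥ x) / 2 := by
  have h1 : smoothRadius δ b x ≤ |x ⬝ᵥ b| + δ * √(x ⬝ᵥ x) := by
    refine Real.sqrt_le_iff.2 ⟨by positivity, ?_⟩
    have h2 := Real.sq_sqrt (dotProduct_self_nonneg_real x)
    have h3 : 0 ≤ |x ⬝ᵥ b| * (δ * √(x ⬝ᵥ x)) := by positivity
    rw [add_sq, mul_pow, h2, sq_abs]
    nlinarith
  unfold smoothPart
  rcases le_total 0 (x ⬝ᵥ b) with h | h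
  · rw [abs_of_nonneg h] at h1
    rw [max_eq_left h]
    linarith
  · rw [abs_of_nonpos h] at h1
    rw [max_eq_right h]
    linarith

theorem smoothPart_smul {t : ℝ} (ht : 0 ≤ t) : smoothPart δ b (t • x) = t * smoothPart δ b x := by
  have : smoothRadius δ b (t • x) = t * smoothRadius δ b x := by
    unfold smoothRadius
    rw [← Real.sqrt_sq ht, ← Real.sqrt_mul (sq_nonneg t), Real.sqrt_sq ht]
    congr 1
    simp only [smul_dotProduct, dotProduct_smul, smul_eq_mul]
    ring
  rw [smoothPart, smoothPart, this, smul_dotProduct, smul_eq_mul]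
  ring

/-- The radius is the Euclidean norm of (⟨x, b⟩, δx), so its triangle inequality is Cauchy–Schwarz
for these vectors. -/
theorem smoothPart_add_le (y : Fin n → ℝ) :
    smoothPart δ b (x + y) ≤ smoothPart δ b x + smoothPart δ b y := by
  have hcs : (x ⬝ᵥ y) ^ 2 ≤ (x ⬝ᵥ x) * (y ⬝ᵥ y) := by
    simpa [dotProduct, sq] using Finset.sum_mul_sq_le_sq_mul_sq Finset.univ x y
  have hx := dotProduct_self_nonneg_real x
  have hy := dotProduct_self_nonneg_real y
  have hsub : smoothRadius δ b (x + y) ≤ smoothRadius δ b x + smoothRadius δ b y := by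
    refine Real.sqrt_le_iff.2 ⟨add_nonneg (Real.sqrt_nonneg _) (Real.sqrt_nonneg _), ?_⟩
    have h1 : smoothRadius δ b x ^ 2 = (x ⬝ᵥ b) ^ 2 + δ ^ 2 * (x ⬝ᵥ x) :=
      Real.sq_sqrt (by positivity)
    have h2 : smoothRadius δ b y ^ 2 = (y ⬝ᵥ b) ^ 2 + δ ^ 2 * (y ⬝ᵥ y) :=
      Real.sq_sqrt (by positivity)
    have h3 : (x ⬝ᵥ b) * (y ⬝ᵥ b) + δ ^ 2 * (x ⬝ᵥ y) ≤ smoothRadius δ b x * smoothRadius δ b y := by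
      refine (le_abs_self _).trans (abs_le_of_sq_le_sq ?_ (mul_nonneg (Real.sqrt_nonneg _) (Real.sqrt_nonneg _)))
      rw [mul_pow, h1, h2]
      have h4 : 2 * ((x ⬝ᵥ b) * (y ⬝ᵥ b)) * (x ⬝ᵥ y) ≤
          (x ⬝ᵥ b) ^ 2 * (y ⬝ᵥ y) + (x ⬝ᵥ x) * (y ⬝ᵥ b) ^ 2 := by
        have := dotProduct_self_nonneg_real ((x ⬝ᵥ b) • y - (y ⬝ᵥ b) • x)
        simp only [sub_dotProduct, dotProduct_sub, smul_dotProduct, dotProduct_smul, smul_eq_mul,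
          dotProduct_comm y x] at this
        linarith
      nlinarith [mul_le_mul_of_nonneg_left h4 (sq_nonneg δ),
        mul_le_mul_of_nonneg_left hcs (mul_nonneg (sq_nonneg δ) (sq_nonneg δ))]
    simp only [add_dotProduct, dotProduct_add, dotProduct_comm y x]
    nlinarith
  unfold smoothPart
  rw [add_dotProduct]
  linarith

theorem continuous_smoothPart : Continuous (smoothPart δ b) := by
  unfold smoothPart smoothRadius dotProduct
  fun_prop

variable {x} in
theorem contDiffAt_smoothPart (hδ : 0 < δ) (hx : x ≠ 0) : ContDiffAt ℝ ∞ (smoothPart δ b) x := by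
  have h1 : ContDiff ℝ ∞ fun y : Fin n → ℝ => y ⬝ᵥ b := by
    unfold dotProduct
    fun_prop
  have h2 : ContDiff ℝ ∞ fun y : Fin n → ℝ => y ⬝ᵥ y := by
    unfold dotProduct
    fun_prop
  have h3 : ContDiffAt ℝ ∞ (smoothRadius δ b) x :=
    ContDiffAt.sqrt ((h1.pow 2).add (contDiff_const.mul h2)).contDiffAt
      (Real.sqrt_pos.1 (smoothRadius_pos b hδ hx)).ne'
  exact (h1.contDiffAt.add h3).div_const 2

variable {x} in
-- Written so that the main term carries the nonnegative factor a/R ≤ 1 in front of ⟨v, b⟩ and the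
-- smoothing contributes an error with factor δ².
theorem hasDerivAt_smoothPart (hδ : 0 < δ) (hx : x ≠ 0) (v : Fin n → ℝ) :
    HasDerivAt (fun t : ℝ => smoothPart δ b (x + t • v))
      ((smoothPart δ b x * (v ⬝ᵥ b) + δ ^ 2 * (x ⬝ᵥ v) / 2) / smoothRadius δ b x) 0 := by
  have hR := smoothRadius_pos b hδ hx
  have h1 : HasDerivAt (fun t : ℝ => (x + t • v) ⬝ᵥ b) (v ⬝ᵥ b) 0 := by
    simp only [add_dotProduct, smul_dotProduct, smul_eq_mul]
    simpa using ((hasDerivAt_id (0 : ℝ)).mul_const (v ⬝ᵥ b)).const_add (x ⬝ᵥ b)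
  have h2 : HasDerivAt (fun t : ℝ => (x + t • v) ⬝ᵥ (x + t • v)) (2 * (x ⬝ᵥ v)) 0 := by
    have : (fun t : ℝ => (x + t • v) ⬝ᵥ (x + t • v)) =
        fun t : ℝ => x ⬝ᵥ x + (t * (2 * (x ⬝ᵥ v)) + t ^ 2 * (v ⬝ᵥ v)) := by
      ext t
      simp only [add_dotProduct, dotProduct_add, smul_dotProduct, dotProduct_smul, smul_eq_mul,
        dotProduct_comm v x]
      ring
    rw [this]
    simpa using (((hasDerivAt_id (0 : ℝ)).mul_const (2 * (x ⬝ᵥ v))).add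
      (((hasDerivAt_id (0 : ℝ)).pow 2).mul_const (v ⬝ᵥ v))).const_add (x ⬝ᵥ x)
  have h3 := ((h1.pow 2).add (h2.const_mul (δ ^ 2))).sqrt (by
    simpa using (Real.sqrt_pos.1 hR).ne')
  have h4 := (h1.add h3).div_const 2
  refine h4.congr_deriv ?_
  have hR' : √((x ⬝ᵥ b) ^ 2 + δ ^ 2 * (x ⬝ᵥ x)) = smoothRadius δ b x := rfl
  simp only [zero_smul, add_zero, Pi.add_apply, Pi.pow_apply, hR']
  unfold smoothPart
  field_simp
  ring

end smoothPart

/-! ### Smoothed `ℓᵖ`-potentials -/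

/-- The potential `(∑ᵢ aᵢ(x)ᵖ)^{2/p} + δ |x|²`, where `aᵢ` is a smoothing of the positive part of
`⟨x, bᵢ⟩`. -/
noncomputable def smoothPotential {n : ℕ} {ι : Type*} [Fintype ι] (b : ι → Fin n → ℝ) (p : ℕ)
    (δ : ℝ) (x : Fin n → ℝ) : ℝ :=
  (∑ i, smoothPart δ (b i) x ^ p) ^ (2 / p : ℝ) + δ * (x ⬝ᵥ x)

section smoothPotential

variable {n : ℕ} {ι : Type*} [Fintype ι] (b : ι → Fin n → ℝ) {p : ℕ} {δ : ℝ}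

/-- Minkowski's inequality in ℓᵖ, combined with the subadditivity and homogeneity of each smoothed
part. -/
theorem convexOn_smoothNorm (hp : 1 ≤ p) :
    ConvexOn ℝ Set.univ fun x => (∑ i, smoothPart δ (b i) x ^ p) ^ (1 / p : ℝ) := by
  have hp' : (1 : ℝ) ≤ p := by exact_mod_cast hp
  have hsmul : ∀ (t : ℝ) (x : Fin n → ℝ), 0 ≤ t →
      (∑ i, smoothPart δ (b i) (t • x) ^ p) ^ (1 / p : ℝ) =
        t * (∑ i, smoothPart δ (b i) x ^ p) ^ (1 / p : ℝ) := by
    intro t x ht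
    simp only [smoothPart_smul _ _ ht, mul_pow, ← Finset.mul_sum]
    rw [Real.mul_rpow (by positivity) (Finset.sum_nonneg fun i _ =>
      pow_nonneg (smoothPart_nonneg _ _) _), one_div, Real.pow_rpow_inv_natCast ht (by omega)]
  refine ⟨convex_univ, fun x _ y _ s t hs ht _ => ?_⟩
  have h1 := Real.Lp_add_le_of_nonneg (s := Finset.univ) (p := p)
    (f := fun i => smoothPart δ (b i) (s • x)) (g := fun i => smoothPart δ (b i) (t • y)) hp'
    (fun i _ => smoothPart_nonneg _ _) (fun i _ => smoothPart_nonneg _ _)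
  simp only [Real.rpow_natCast] at h1
  simp only [smul_eq_mul]
  rw [← hsmul s x hs, ← hsmul t y ht]
  refine le_trans ?_ h1
  refine Real.rpow_le_rpow (Finset.sum_nonneg fun i _ => pow_nonneg (smoothPart_nonneg _ _) _)
    (Finset.sum_le_sum fun i _ => ?_) (by positivity)
  exact pow_le_pow_left₀ (smoothPart_nonneg _ _) (smoothPart_add_le _ _ _) _

theorem smoothPotential_isStronglyConvexQuadratic (hp : 1 ≤ p) (hδ : 0 < δ)
    (hb : (∃ x : Fin n → ℝ, x ≠ 0) → Nonempty ι) :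
    IsStronglyConvexQuadratic δ (smoothPotential b p δ) := by
  have hsum : ∀ x, 0 ≤ ∑ i, smoothPart δ (b i) x ^ p := fun x =>
    Finset.sum_nonneg fun i _ => pow_nonneg (smoothPart_nonneg _ _) _
  have hp0 : (p : ℝ) ≠ 0 := by positivity
  refine ⟨hδ, ?_, fun t x ht => ?_, fun x hx => ?_, ?_⟩
  · have h1 : Continuous fun x => ∑ i, smoothPart δ (b i) x ^ p :=
      continuous_finsetSum _ fun i _ => (continuous_smoothPart (b i)).pow p
    have h2 : Continuous fun x : Fin n → ℝ => x ⬝ᵥ x := by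
      unfold dotProduct
      fun_prop
    exact (h1.rpow_const fun x => Or.inr (by positivity)).add (continuous_const.mul h2)
  · simp only [smoothPotential, smoothPart_smul _ _ ht.le, mul_pow, ← Finset.mul_sum,
      smul_dotProduct, dotProduct_smul, smul_eq_mul]
    rw [Real.mul_rpow (by positivity) (hsum x), ← Real.rpow_natCast_mul ht.le,
      mul_div_cancel₀ _ hp0]
    norm_cast
    ring
  · have := hb ⟨x, hx⟩
    have h1 : ContDiffAt ℝ ∞ (fun x => ∑ i, smoothPart δ (b i) x ^ p) x :=
      ContDiffAt.sum fun i _ => (contDiffAt_smoothPart (b i) hδ hx).pow p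
    have h2 : ContDiff ℝ ∞ fun x : Fin n → ℝ => x ⬝ᵥ x := by
      unfold dotProduct
      fun_prop
    have hpos : 0 < ∑ i, smoothPart δ (b i) x ^ p :=
      Finset.sum_pos (fun i _ => pow_pos (smoothPart_pos (b i) hδ hx) _) Finset.univ_nonempty
    exact ((h1.rpow_const_of_ne hpos.ne').add
      (contDiffAt_const.mul h2.contDiffAt)).contDiffWithinAt
  -- Removing δ|x|² leaves the square of a nonnegative convex function.
  · have h1 := (convexOn_smoothNorm (δ := δ) b hp).pow
      (fun x _ => Real.rpow_nonneg (hsum x) _) 2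
    refine h1.congr fun x _ => ?_
    simp only [smoothPotential, add_sub_cancel_right, Pi.pow_apply]
    rw [← Real.rpow_mul_natCast (hsum x)]
    congr 1
    push_cast
    ring

theorem fderiv_smoothPotential (hp : 1 ≤ p) (hδ : 0 < δ) [Nonempty ι] {x : Fin n → ℝ} (hx : x ≠ 0)
    (v : Fin n → ℝ) :
    fderiv ℝ (smoothPotential b p δ) x v =
      2 * (∑ i, smoothPart δ (b i) x ^ p) ^ (2 / p - 1 : ℝ) *
        (∑ i, smoothPart δ (b i) x ^ (p - 1) *
          ((smoothPart δ (b i) x * (v ⬝ᵥ b i) + δ ^ 2 * (x ⬝ᵥ v) / 2) / smoothRadius δ (b i) x)) +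
      2 * δ * (x ⬝ᵥ v) := by
  have hφ := smoothPotential_isStronglyConvexQuadratic b hp hδ (fun _ => ‹_›)
  have hl : HasDerivAt (fun t : ℝ => x + t • v) v 0 := by
    simpa using ((hasDerivAt_id (0 : ℝ)).smul_const v).const_add x
  have h0 : HasDerivAt (fun t : ℝ => smoothPotential b p δ (x + t • v))
      (fderiv ℝ (smoothPotential b p δ) x v) 0 := by
    have : HasFDerivAt (smoothPotential b p δ) (fderiv ℝ (smoothPotential b p δ) x)
        (x + (0 : ℝ) • v) := by
      simpa using (hφ.differentiable x).hasFDerivAt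
    exact this.comp_hasDerivAt (0 : ℝ) hl
  have hpos : 0 < ∑ i, smoothPart δ (b i) x ^ p :=
    Finset.sum_pos (fun i _ => pow_pos (smoothPart_pos (b i) hδ hx) _) Finset.univ_nonempty
  have h1 := HasDerivAt.fun_sum (u := Finset.univ) fun i _ =>
    (hasDerivAt_smoothPart (b i) hδ hx v).fun_pow p
  have h2 := h1.rpow_const (p := (2 / p : ℝ)) (Or.inl (by simpa using hpos.ne'))
  have h3 : HasDerivAt (fun t : ℝ => (x + t • v) ⬝ᵥ (x + t • v)) (2 * (x ⬝ᵥ v)) 0 := by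
    obtain ⟨L, hL, hLv⟩ := hasFDerivAt_dotProduct_self x
    have : HasFDerivAt (fun y : Fin n → ℝ => y ⬝ᵥ y) L (x + (0 : ℝ) • v) := by simpa using hL
    rw [← hLv]
    exact HasFDerivAt.comp_hasDerivAt (f := fun t : ℝ => x + t • v)
      (l := fun y : Fin n → ℝ => y ⬝ᵥ y) (0 : ℝ) this hl
  rw [h0.unique (h2.add (h3.const_mul δ))]
  have hp0 : (p : ℝ) ≠ 0 := by positivity
  simp only [zero_smul, add_zero, mul_assoc, ← Finset.mul_sum]
  generalize (∑ i, smoothPart δ (b i) x ^ p) ^ (2 / p - 1 : ℝ) = E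
  generalize ∑ i, smoothPart δ (b i) x ^ (p - 1) * _ = A
  field_simp

end smoothPotential

/-! ### The derivative of the potential on the boundary of the polytope -/

/-- The geometric sum 1 + t + ⋯ + tᵐ is at least (m + 1)tᵐ, and its product with 1 - t is 1 -
t^{m+1}. -/
theorem succ_mul_pow_mul_one_sub_le {t : ℝ} (h0 : 0 ≤ t) (h1 : t ≤ 1) (m : ℕ) :
    (m + 1) * (t ^ m * (1 - t)) ≤ 1 := by
  have h2 : (m + 1) * t ^ m ≤ ∑ k ∈ Finset.range (m + 1), t ^ k := by
    have : ∑ _k ∈ Finset.range (m + 1), t ^ m ≤ ∑ k ∈ Finset.range (m + 1), t ^ k :=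
      Finset.sum_le_sum fun k hk => pow_le_pow_of_le_one h0 h1
        (Nat.lt_succ_iff.1 (Finset.mem_range.1 hk))
    simpa using this
  have h3 := mul_neg_geom_sum t (m + 1)
  have h4 := mul_le_mul_of_nonneg_left h2 (sub_nonneg.2 h1)
  have h5 := pow_nonneg h0 (m + 1)
  nlinarith

/-- This limits how much a single ray can push the derivative up: a is the smoothed positive part of
the pairing u. For u ≥ 0 rescale a by 1 + d to reach the unsmoothed bound; for u ≤ 0 already aᵐ ≤ d.
-/
theorem pow_mul_one_sub_le {a u d K : ℝ} {m : ℕ} (hm : 1 ≤ m) (ha : 0 ≤ a) (had : a ≤ max u 0 + d)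
    (hd : 0 ≤ d) (hu : u ≤ 1) (huK : 1 - u ≤ K) (hdK : d * K ≤ 2 / (m + 1)) (hd1 : d ≤ 1)
    (hdm : (1 + d) ^ (m + 1) ≤ 2) : a ^ m * (1 - u) ≤ 2 / (m + 1) := by
  have hm0 : (0 : ℝ) < m + 1 := by positivity
  rcases le_total 0 u with h | h
  · rw [max_eq_left h] at had
    have hd0 : 0 < 1 + d := by linarith
    have h1 := succ_mul_pow_mul_one_sub_le (t := a / (1 + d)) (by positivity)
      ((div_le_one hd0).2 (by linarith)) m
    have h2 : a ^ m * (1 + d - a) =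
        (1 + d) ^ (m + 1) * ((a / (1 + d)) ^ m * (1 - a / (1 + d))) := by
      rw [div_pow]
      field_simp
      ring
    have h3 : a ^ m * (1 - u) ≤ a ^ m * (1 + d - a) :=
      mul_le_mul_of_nonneg_left (by linarith) (by positivity)
    rw [le_div_iff₀ hm0]
    have h4 : 0 ≤ (a / (1 + d)) ^ m * (1 - a / (1 + d)) :=
      mul_nonneg (by positivity) (sub_nonneg.2 ((div_le_one hd0).2 (by linarith)))
    calc a ^ m * (1 - u) * (m + 1) ≤ a ^ m * (1 + d - a) * (m + 1) := by gcongr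
      _ = (1 + d) ^ (m + 1) * ((m + 1) * ((a / (1 + d)) ^ m * (1 - a / (1 + d)))) := by
        rw [h2]; ring
      _ ≤ 2 * 1 := mul_le_mul hdm h1 (by positivity) zero_le_two
      _ = 2 := by ring
  · rw [max_eq_right h, zero_add] at had
    calc a ^ m * (1 - u) ≤ d * K := by
          refine mul_le_mul ?_ huK (by linarith) hd
          calc a ^ m ≤ d ^ m := by gcongr
            _ ≤ d ^ 1 := pow_le_pow_of_le_one hd hd1 hm
            _ = d := pow_one d
      _ ≤ _ := hdK

namespace SmoothCompleteFan

variable {n r : ℕ} (S : SmoothCompleteFan n r)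

theorem exists_polytope_bound : ∃ K ≥ (1 : ℝ), ∀ x ∈ S.polytope,
    √(x ⬝ᵥ x) ≤ K ∧ (∀ y ∈ S.polytope, |x ⬝ᵥ (y - x)| ≤ K) ∧
      ∀ i, 1 - x ⬝ᵥ intVec (S.ray i) ≤ K := by
  obtain ⟨C, hC0, hC⟩ := S.exists_norm_le_of_mem_polytope
  let B : ℝ := ∑ i, ‖intVec (S.ray i)‖
  have hB : ∀ i, ‖intVec (S.ray i)‖ ≤ B := fun i =>
    Finset.single_le_sum (f := fun i => ‖intVec (S.ray i)‖) (fun _ _ => norm_nonneg _)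
      (Finset.mem_univ i)
  have hB0 : 0 ≤ B := Finset.sum_nonneg fun _ _ => norm_nonneg _
  refine ⟨1 + n * C * C + n * C * (C + C) + n * C * B,
    by have : 0 ≤ n * C * C + n * C * (C + C) + n * C * B := by positivity
       linarith, fun x hx => ⟨?_, fun y hy => ?_, fun i => ?_⟩⟩
  · refine Real.sqrt_le_iff.2 ⟨by positivity, ?_⟩
    have h1 := (le_abs_self _).trans (abs_dotProduct_le x x)
    have h2 : n * ‖x‖ * ‖x‖ ≤ n * C * C := by
      have := hC x hx
      gcongr
    have h3 : 0 ≤ n * C * (C + C) + n * C * B := by positivity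
    have h4 : 0 ≤ n * C * C := by positivity
    nlinarith
  · have h2 : n * ‖x‖ * ‖y - x‖ ≤ n * C * (C + C) := by
      have h3 := hC x hx
      have h4 := hC y hy
      have h5 := norm_sub_le y x
      gcongr
      linarith
    have h3 : 0 ≤ 1 + n * C * C + n * C * B := by positivity
    linarith [abs_dotProduct_le x (y - x)]
  · have h1 := (abs_le.1 (abs_dotProduct_le x (intVec (S.ray i)))).1
    have h2 : n * ‖x‖ * ‖intVec (S.ray i)‖ ≤ n * C * B := by
      have h3 := hC x hx
      have h4 := hB i
      gcongr
    have h3 : 0 ≤ n * C * C + n * C * (C + C) := by positivity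
    linarith

set_option maxHeartbeats 1000000 in
/-- For a suitable smoothed `ℓᵖ`-potential, the derivative at a boundary point `x` of the polytope
is negative towards every point `y` of the polytope that moves away from a facet nearly containing
`x`. -/
theorem exists_potential_fderiv_le {γ : ℝ} (hγ0 : 0 < γ) (hγ1 : γ ≤ 1) :
    ∃ (δ : ℝ) (φ : (Fin n → ℝ) → ℝ), IsStronglyConvexQuadratic δ φ ∧ ∃ η > 0, ∃ κ > 0,
      ∀ x y : Fin n → ℝ, S.height x = 1 → y ∈ S.polytope → ∀ i,
        1 - η ≤ x ⬝ᵥ intVec (S.ray i) → y ⬝ᵥ intVec (S.ray i) ≤ 1 - γ →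
        fderiv ℝ φ x (y - x) ≤ -κ := by
  obtain ⟨K, hK1, hK⟩ := S.exists_polytope_bound
  obtain ⟨N, hN⟩ : ∃ N : ℝ, N = r + 1 := ⟨_, rfl⟩
  have hN1 : 1 ≤ N := by rw [hN]; linarith [(Nat.cast_nonneg r : (0 : ℝ) ≤ r)]
  -- The exponent p = m + 2 is so large that the harmful contributions, at most 2/p per ray, total
  -- at most γ/32.
  obtain ⟨m, hm⟩ := exists_nat_ge (64 * N / γ)
  obtain ⟨p, hp⟩ : ∃ p : ℝ, p = m + 2 := ⟨_, rfl⟩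
  have hp2 : 2 ≤ p := by rw [hp]; linarith [(Nat.cast_nonneg m : (0 : ℝ) ≤ m)]
  have hpγ : 64 * N ≤ p * γ := by
    rw [div_le_iff₀ hγ0] at hm
    rw [hp]; linarith
  -- All errors due to smoothing and to the term δ|x|² become small against γ/N, even after the
  -- powers are taken.
  obtain ⟨δ, hδ⟩ : ∃ δ : ℝ, δ = γ / (64 * N * K ^ 2 * p) := ⟨_, rfl⟩
  have hδ0 : 0 < δ := by rw [hδ]; positivity
  have hδ' : δ * (64 * N * K ^ 2 * p) = γ := by
    rw [hδ]; field_simp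
  -- On the polytope a smoothed part exceeds the true positive part by at most d.
  obtain ⟨d, hd⟩ : ∃ d : ℝ, d = δ * K / 2 := ⟨_, rfl⟩
  have hd0 : 0 ≤ d := by rw [hd]; positivity
  have hdK : d * K * (128 * p) ≤ 1 := by
    have h1 : δ * (64 * K ^ 2 * p) * 1 ≤ δ * (64 * K ^ 2 * p) * N := by gcongr
    rw [hd]
    nlinarith
  have hdp : d * (128 * p) ≤ 1 := by
    have : d * (128 * p) * 1 ≤ d * (128 * p) * K := by gcongr
    linarith
  have hd1 : d ≤ 1 := by nlinarith
  have hdm : (1 + d) ^ (m + 2) ≤ 2 := by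
    have h1 : (1 + d) ^ (m + 2) ≤ Real.exp d ^ (m + 2) := by
      have := Real.add_one_le_exp d
      gcongr
      linarith
    rw [← Real.exp_nat_mul] at h1
    have h2 : ((m + 2 : ℕ) : ℝ) * d ≤ 1 / 2 := by push_cast; rw [← hp]; linarith
    have h3 := Real.exp_le_exp.2 h2
    have h4 : Real.exp (1 / 2) ≤ 2 := by
      have h5 : Real.exp (1 / 2) ^ 2 = Real.exp 1 := by
        rw [← Real.exp_nat_mul]; norm_num
      have h6 := Real.exp_one_lt_three
      have h7 := Real.exp_pos (1 / 2)
      nlinarith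
    linarith
  have hnonempty : (∃ x : Fin n → ℝ, x ≠ 0) → Nonempty (Fin r) := fun ⟨x, hx⟩ =>
    ⟨(S.exists_dotProduct_ray_pos hx).choose⟩
  refine ⟨δ, smoothPotential (fun i => intVec (S.ray i)) (m + 2) δ,
    smoothPotential_isStronglyConvexQuadratic _ (by omega) hδ0 hnonempty, 1 / (2 * p),
    by positivity, γ / (32 * N), by positivity, fun x y hx hy i₀ hi₀ hyi₀ => ?_⟩
  have hne : Nonempty (Fin r) := ⟨i₀⟩
  have hx0 : x ≠ 0 := by
    rintro rfl
    simp [height] at hx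
  have hxP : x ∈ S.polytope := S.mem_polytope_of_height_le hx.le
  obtain ⟨hQ, hq, hu⟩ := hK x hxP
  replace hq := hq y hy
  rw [fderiv_smoothPotential _ (by omega) hδ0 hx0]
  set a : Fin r → ℝ := fun i => smoothPart δ (intVec (S.ray i)) x with ha
  set R : Fin r → ℝ := fun i => smoothRadius δ (intVec (S.ray i)) x with hR
  set u : Fin r → ℝ := fun i => x ⬝ᵥ intVec (S.ray i) with hu_def
  set q : ℝ := x ⬝ᵥ (y - x) with hq_def
  have ha0 : ∀ i, 0 < a i := fun i => smoothPart_pos _ hδ0 hx0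
  have hR0 : ∀ i, 0 < R i := fun i => smoothRadius_pos _ hδ0 hx0
  have haR : ∀ i, a i ≤ R i := fun i => smoothPart_le_smoothRadius _ _
  have had : ∀ i, a i ≤ max (u i) 0 + d := fun i => by
    refine (smoothPart_le _ _ hδ0).trans ?_
    rw [hd]
    gcongr
  have hu1 : ∀ i, u i ≤ 1 := hxP
  have ha1 : ∀ i, a i ≤ 1 + d := fun i => (had i).trans (by
    gcongr
    exact max_le (hu1 i) zero_le_one)
  have hw : ∀ i, (y - x) ⬝ᵥ intVec (S.ray i) ≤ 1 - u i := fun i => by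
    rw [sub_dotProduct]
    linarith [hy i]
  have hpow : ∀ i, ∀ k ≤ m + 2, a i ^ k ≤ 2 := fun i k hk =>
    calc a i ^ k ≤ (1 + d) ^ k := pow_le_pow_left₀ (ha0 i).le (ha1 i) k
      _ ≤ (1 + d) ^ (m + 2) := pow_le_pow_right₀ (by linarith) hk
      _ ≤ 2 := hdm
  have herr : ∀ i, a i ^ (m + 1) * ((δ ^ 2 * q / 2) / R i) ≤ δ ^ 2 * K := fun i => by
    have h1 : a i ^ (m + 1) / R i ≤ 2 := by
      rw [div_le_iff₀ (hR0 i), pow_succ]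
      exact mul_le_mul (hpow i m (by omega)) (haR i) (ha0 i).le zero_le_two
    calc a i ^ (m + 1) * ((δ ^ 2 * q / 2) / R i) = a i ^ (m + 1) / R i * (δ ^ 2 * q / 2) := by ring
      _ ≤ a i ^ (m + 1) / R i * (δ ^ 2 * K / 2) := by
        have := (le_abs_self q).trans hq
        have := hR0 i
        have := ha0 i
        gcongr
      _ ≤ 2 * (δ ^ 2 * K / 2) := by gcongr
      _ = δ ^ 2 * K := by ring
  have hmain : ∀ i, a i ^ (m + 1) * (a i * ((y - x) ⬝ᵥ intVec (S.ray i)) / R i) ≤ 2 / p := fun i => by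
    have h1 : a i ^ (m + 1) * (1 - u i) ≤ 2 / p := by
      have hpm : p = ((m + 1 : ℕ) : ℝ) + 1 := by push_cast; rw [hp]; ring
      rw [hpm]
      refine pow_mul_one_sub_le (d := d) (K := K) (by omega) (ha0 i).le (had i) hd0 (hu1 i) (hu i)
        ?_ hd1 hdm
      rw [← hpm, le_div_iff₀ (by positivity)]
      nlinarith
    have h2 : a i / R i ≤ 1 := (div_le_one (hR0 i)).2 (haR i)
    have h3 : 0 ≤ 1 - u i := sub_nonneg.2 (hu1 i)
    have := hR0 i
    have := ha0 i
    calc a i ^ (m + 1) * (a i * ((y - x) ⬝ᵥ intVec (S.ray i)) / R i)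
        = a i ^ (m + 1) * (a i / R i) * ((y - x) ⬝ᵥ intVec (S.ray i)) := by ring
      _ ≤ a i ^ (m + 1) * 1 * (1 - u i) := by
          have := hw i
          calc _ ≤ a i ^ (m + 1) * (a i / R i) * (1 - u i) := by gcongr
            _ ≤ _ := by gcongr
      _ ≤ 2 / p := by rw [mul_one]; exact h1
  have hηp : 1 / (2 * p) ≤ γ / 2 := by
    rw [div_le_div_iff₀ (by positivity) two_pos]
    linarith
  -- The distinguished facet gives the decrease: the pairing is at most -γ/2, and both remaining
  -- factors are at least 1/2. For the power this is Bernoulli's inequality, which dictates η =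
  -- 1/(2p).
  have hmain₀ : a i₀ ^ (m + 1) * (a i₀ * ((y - x) ⬝ᵥ intVec (S.ray i₀)) / R i₀) ≤ -(γ / 8) := by
    have h1 : (y - x) ⬝ᵥ intVec (S.ray i₀) ≤ -(γ / 2) := by
      rw [sub_dotProduct]
      linarith
    have h2 : 1 / 2 ≤ a i₀ ^ (m + 1) := by
      have h3 : -2 ≤ -(1 / (2 * p)) := by
        have : 1 / (2 * p) ≤ 1 := by linarith
        linarith
      have h4 := one_add_mul_le_pow h3 (m + 1)
      have h5 : (1 / 2 : ℝ) ≤ 1 + ((m + 1 : ℕ) : ℝ) * -(1 / (2 * p)) := by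
        have : ((m + 1 : ℕ) : ℝ) * (1 / (2 * p)) ≤ 1 / 2 := by
          rw [mul_one_div, div_le_div_iff₀ (by positivity) two_pos]
          push_cast
          linarith
        linarith
      have h6 : 1 + -(1 / (2 * p)) ≤ a i₀ := by
        have := dotProduct_le_smoothPart (δ := δ) (intVec (S.ray i₀)) x
        simp only [ha]
        linarith
      have h7 : 0 ≤ 1 + -(1 / (2 * p)) := by linarith
      exact h5.trans (h4.trans (pow_le_pow_left₀ h7 h6 _))
    have h8 : 1 / 2 ≤ a i₀ / R i₀ := by
      rw [le_div_iff₀ (hR0 i₀)]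
      have : 0 ≤ u i₀ := by
        simp only [hu_def]
        linarith
      simp only [ha, hR, smoothPart]
      linarith
    have h9 : 1 / 2 * (1 / 2) ≤ a i₀ ^ (m + 1) * (a i₀ / R i₀) := by gcongr
    calc a i₀ ^ (m + 1) * (a i₀ * ((y - x) ⬝ᵥ intVec (S.ray i₀)) / R i₀)
        = a i₀ ^ (m + 1) * (a i₀ / R i₀) * ((y - x) ⬝ᵥ intVec (S.ray i₀)) := by ring
      _ ≤ -(γ / 8) := by nlinarith
  have hT : ∑ i, a i ^ (m + 1) * ((a i * ((y - x) ⬝ᵥ intVec (S.ray i)) + δ ^ 2 * q / 2) / R i) ≤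
      -(γ / 16) := by
    have hterm : ∀ i, a i ^ (m + 1) *
        ((a i * ((y - x) ⬝ᵥ intVec (S.ray i)) + δ ^ 2 * q / 2) / R i) ≤
        (2 / p + δ ^ 2 * K) - if i₀ = i then γ / 8 else 0 := fun i => by
      rw [add_div, mul_add]
      have h1 := herr i
      have h2 := hmain i
      split_ifs with h
      · subst h
        have : 0 ≤ 2 / p := by positivity
        linarith
      · linarith
    refine (Finset.sum_le_sum fun i _ => hterm i).trans ?_
    rw [Finset.sum_sub_distrib, Finset.sum_ite_eq]
    simp only [Finset.sum_const, Finset.card_univ, Fintype.card_fin, nsmul_eq_mul,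
      Finset.mem_univ, if_true]
    have h1 : (r : ℝ) * (2 / p + δ ^ 2 * K) ≤ N * (2 / p + δ ^ 2 * K) := by
      have : (r : ℝ) ≤ N := by rw [hN]; linarith
      gcongr
    have h2 : N * (2 / p) ≤ γ / 32 := by
      rw [mul_div_assoc', div_le_div_iff₀ (by positivity) (by norm_num)]
      linarith
    have h3 : N * (δ ^ 2 * K) ≤ γ / 32 := by
      have h4 : N * (δ * K) ≤ γ / 64 := by
        have : N * (δ * K) * (1 * 1) ≤ N * (δ * K) * (K * p) := by
          have : 1 ≤ p := by linarith
          gcongr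
        nlinarith
      have h5 : δ ≤ 1 := by
        have : δ * 1 ≤ δ * (64 * N * K ^ 2 * p) := by
          have : 1 ≤ K ^ 2 := one_le_pow₀ hK1
          have : (1 : ℝ) * 1 * 1 * 1 ≤ 64 * N * K ^ 2 * p := by
            gcongr
            · norm_num
            · linarith
          gcongr
          linarith
        linarith
      calc N * (δ ^ 2 * K) = δ * (N * (δ * K)) := by ring
        _ ≤ 1 * (γ / 64) := by gcongr
        _ ≤ γ / 32 := by linarith
    linarith
  set s : ℝ := ∑ i, a i ^ (m + 2) with hs
  have hs1 : 1 ≤ s := by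
    obtain ⟨i, hi⟩ := S.exists_eq_height hx0
    have h1 : 1 ≤ a i := by
      have := dotProduct_le_smoothPart (δ := δ) (intVec (S.ray i)) x
      rw [hi, hx] at this
      exact this
    calc (1 : ℝ) ≤ a i ^ (m + 2) := one_le_pow₀ h1
      _ ≤ s := Finset.single_le_sum (f := fun i => a i ^ (m + 2))
        (fun j _ => pow_nonneg (ha0 j).le _) (Finset.mem_univ i)
  have hs2 : s ≤ 2 * N := by
    calc s ≤ ∑ _i : Fin r, (2 : ℝ) := Finset.sum_le_sum fun i _ => hpow i _ le_rfl
      _ ≤ 2 * N := by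
        simp only [Finset.sum_const, Finset.card_univ, Fintype.card_fin, nsmul_eq_mul, hN]
        linarith
  -- The outer factor may not spoil the negative sum: since 1 ≤ s ≤ 2N, it is at least 1/s.
  have hE : 1 / (2 * N) ≤ s ^ (2 / ((m + 2 : ℕ) : ℝ) - 1) := by
    calc 1 / (2 * N) ≤ 1 / s := one_div_le_one_div_of_le (by linarith) hs2
      _ = s ^ (-1 : ℝ) := by rw [Real.rpow_neg_one, one_div]
      _ ≤ _ := Real.rpow_le_rpow_of_exponent_le hs1 (by
        have : (0 : ℝ) ≤ 2 / ((m + 2 : ℕ) : ℝ) := by positivity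
        linarith)
  have h1 : s ^ (2 / ((m + 2 : ℕ) : ℝ) - 1) *
      (∑ i, a i ^ (m + 1) * ((a i * ((y - x) ⬝ᵥ intVec (S.ray i)) + δ ^ 2 * q / 2) / R i)) ≤
      1 / (2 * N) * -(γ / 16) := by
    have : 0 ≤ 1 / (2 * N) := by positivity
    nlinarith
  have h2 : 2 * δ * q ≤ γ / (64 * N) := by
    have h3 : δ * q ≤ δ * K := by
      have := (le_abs_self q).trans hq
      gcongr
    have h4 : δ * K * (64 * N) * (1 * 2) ≤ δ * K * (64 * N) * (K * p) := by gcongr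
    rw [le_div_iff₀ (by positivity)]
    calc 2 * δ * q * (64 * N) = δ * q * (64 * N * 2) := by ring
      _ ≤ δ * K * (64 * N * 2) := by gcongr
      _ = δ * K * (64 * N) * (1 * 2) := by ring
      _ ≤ δ * K * (64 * N) * (K * p) := h4
      _ = γ := by rw [← hδ']; ring
  have h3 : 1 / (2 * N) * -(γ / 16) * 2 + γ / (64 * N) ≤ -(γ / (32 * N)) := by
    have : γ / (64 * N) = γ / N / 64 := by field_simp
    have : γ / (32 * N) = γ / N / 32 := by field_simp
    have : 1 / (2 * N) * -(γ / 16) * 2 = -(γ / N / 16) := by field_simp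
    have : 0 ≤ γ / N := by positivity
    linarith
  have hm1 : m + 2 - 1 = m + 1 := rfl
  rw [hm1]
  linarith

end SmoothCompleteFan

/-! ### Faces of the polytope and the choice of potential -/

theorem LinearMap.apply_eq_of_mem_affineSpan {E : Type*} [AddCommGroup E] [Module ℝ E]
    (f : E →ₗ[ℝ] ℝ) {F : Set E} {c : ℝ} (h : ∀ y ∈ F, f y = c) {z : E} (hz : z ∈ affineSpan ℝ F) :
    f z = c := by
  rcases F.eq_empty_or_nonempty with rfl | ⟨x, hx⟩
  · rw [AffineSubspace.span_empty] at hz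
    exact absurd hz (AffineSubspace.notMem_bot ℝ E z)
  have hle : affineSpan ℝ F ≤ AffineSubspace.mk' x (LinearMap.ker f) := by
    rw [affineSpan_le]
    intro y hy
    simp [AffineSubspace.mem_mk', h y hy, h x hx]
  have := hle hz
  rw [AffineSubspace.mem_mk', vsub_eq_sub, LinearMap.mem_ker, map_sub, h x hx, sub_eq_zero] at this
  exact this

/-- The linear form `x ↦ ⟨x, b⟩`. -/
def dotProductForm {n : ℕ} (b : Fin n → ℝ) : (Fin n → ℝ) →ₗ[ℝ] ℝ where
  toFun x := x ⬝ᵥ b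
  map_add' x y := add_dotProduct x y b
  map_smul' t x := smul_dotProduct t x b

namespace SmoothCompleteFan

variable {n r : ℕ} (S : SmoothCompleteFan n r)

/-- There are finitely many sets of facets, so one γ works for all those that occur as the facets
through a point. -/
theorem exists_polytope_gap : ∃ γ : ℝ, 0 < γ ∧ γ ≤ 1 ∧ ∀ I : Finset (Fin r),
    (∃ y ∈ S.polytope, ∀ i, y ⬝ᵥ intVec (S.ray i) = 1 ↔ i ∈ I) →
    ∃ y ∈ S.polytope, (∀ i, y ⬝ᵥ intVec (S.ray i) = 1 ↔ i ∈ I) ∧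
      ∀ i ∉ I, y ⬝ᵥ intVec (S.ray i) ≤ 1 - γ := by
  have hev : ∀ a : ℝ, 0 < a → ∀ᶠ γ : ℝ in nhdsWithin 0 (Set.Ioi 0), γ ≤ a := fun a ha =>
    nhdsWithin_le_nhds (Iic_mem_nhds ha)
  have h1 : ∀ᶠ γ : ℝ in nhdsWithin 0 (Set.Ioi 0), ∀ I : Finset (Fin r),
      (∃ y ∈ S.polytope, ∀ i, y ⬝ᵥ intVec (S.ray i) = 1 ↔ i ∈ I) →
      ∃ y ∈ S.polytope, (∀ i, y ⬝ᵥ intVec (S.ray i) = 1 ↔ i ∈ I) ∧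
        ∀ i ∉ I, y ⬝ᵥ intVec (S.ray i) ≤ 1 - γ := by
    rw [Filter.eventually_all]
    intro I
    by_cases hI : ∃ y ∈ S.polytope, ∀ i, y ⬝ᵥ intVec (S.ray i) = 1 ↔ i ∈ I
    · obtain ⟨y, hy, hyI⟩ := hI
      have h2 : ∀ᶠ γ : ℝ in nhdsWithin 0 (Set.Ioi 0), ∀ i, i ∉ I →
          y ⬝ᵥ intVec (S.ray i) ≤ 1 - γ := by
        rw [Filter.eventually_all]
        intro i
        by_cases hi : i ∈ I
        · exact Filter.Eventually.of_forall fun γ h => absurd hi h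
        · have h3 : y ⬝ᵥ intVec (S.ray i) < 1 :=
            lt_of_le_of_ne (hy i) fun h => hi ((hyI i).1 h)
          filter_upwards [hev _ (sub_pos.2 h3)] with γ hγ _
          linarith
      filter_upwards [h2] with γ hγ _
      exact ⟨y, hy, hyI, hγ⟩
    · exact Filter.Eventually.of_forall fun γ h => absurd h hI
  obtain ⟨γ, ⟨h2, h3⟩, h4⟩ := ((h1.and (hev 1 one_pos)).and self_mem_nhdsWithin).exists
  exact ⟨γ, h4, h3, h2⟩

theorem convex_polytope : Convex ℝ S.polytope := by
  intro x hx y hy a b ha hb hab i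
  rw [add_dotProduct, smul_dotProduct, smul_dotProduct, smul_eq_mul, smul_eq_mul]
  nlinarith [hx i, hy i]

/-- For each facet not containing F pick a point of F off it; the average of the picked points is
off all of them. -/
theorem exists_generic_mem {F : Set (Fin n → ℝ)} (hF : Convex ℝ F) (hFP : F ⊆ S.polytope)
    (hne : F.Nonempty) : ∃ y ∈ F, ∀ i, y ⬝ᵥ intVec (S.ray i) = 1 →
      ∀ z ∈ F, z ⬝ᵥ intVec (S.ray i) = 1 := by
  rcases isEmpty_or_nonempty (Fin r) with hr | hr
  · exact ⟨hne.some, hne.some_mem, fun i => isEmptyElim i⟩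
  have hz : ∀ i, ∃ z ∈ F, z ⬝ᵥ intVec (S.ray i) = 1 → ∀ z ∈ F, z ⬝ᵥ intVec (S.ray i) = 1 := by
    intro i
    by_cases h : ∀ z ∈ F, z ⬝ᵥ intVec (S.ray i) = 1
    · exact ⟨hne.some, hne.some_mem, fun _ => h⟩
    · push Not at h
      obtain ⟨z, hz, hz1⟩ := h
      exact ⟨z, hz, fun h => absurd h hz1⟩
  choose z hzF hz using hz
  have hr0 : (0 : ℝ) < r := by
    exact_mod_cast Fin.pos_iff_nonempty.2 hr
  refine ⟨∑ i, (r : ℝ)⁻¹ • z i, hF.sum_mem (fun _ _ => by positivity) (by simp [hr0.ne'])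
    fun i _ => hzF i, fun i hi => hz i ?_⟩
  refine le_antisymm (hFP (hzF i) i) (le_of_not_gt fun hlt => ?_)
  have h1 : (∑ j, (r : ℝ)⁻¹ • z j) ⬝ᵥ intVec (S.ray i) < ∑ _j : Fin r, (r : ℝ)⁻¹ := by
    rw [sum_dotProduct]
    simp only [smul_dotProduct, smul_eq_mul]
    refine Finset.sum_lt_sum (fun j _ => ?_) ⟨i, Finset.mem_univ i, ?_⟩
    · exact mul_le_of_le_one_right (by positivity) (hFP (hzF j) i)
    · exact mul_lt_of_lt_one_right (by positivity) hlt
  rw [hi] at h1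
  simp [hr0.ne'] at h1

/-- If the minimum x lay on a facet not containing F, the derivative towards the generic point y of
F would be negative, although the segment stays in F. -/
theorem exists_isMinOn_intrinsicInterior {φ : (Fin n → ℝ) → ℝ} (hd : Differentiable ℝ φ)
    {γ : ℝ} (hgap : ∀ I : Finset (Fin r),
      (∃ y ∈ S.polytope, ∀ i, y ⬝ᵥ intVec (S.ray i) = 1 ↔ i ∈ I) →
      ∃ y ∈ S.polytope, (∀ i, y ⬝ᵥ intVec (S.ray i) = 1 ↔ i ∈ I) ∧
        ∀ i ∉ I, y ⬝ᵥ intVec (S.ray i) ≤ 1 - γ)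
    (hneg : ∀ x y : Fin n → ℝ, S.height x = 1 → y ∈ S.polytope → ∀ i,
      x ⬝ᵥ intVec (S.ray i) = 1 → y ⬝ᵥ intVec (S.ray i) ≤ 1 - γ → fderiv ℝ φ x (y - x) < 0)
    {F : Set (Fin n → ℝ)} (hexp : IsExposed ℝ S.polytope F) (hne : F.Nonempty) :
    ∃ x ∈ intrinsicInterior ℝ F, IsMinOn φ F x := by
  classical
  have hcompact : IsCompact F := hexp.isCompact S.isCompact_polytope
  have hconv : Convex ℝ F := hexp.convex S.convex_polytope
  have hFP : F ⊆ S.polytope := hexp.subset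
  obtain ⟨l, hl⟩ := hexp hne
  obtain ⟨x, hxF, hmin⟩ := hcompact.exists_isMinOn hne hd.continuous.continuousOn
  obtain ⟨y₀, hy₀F, hy₀⟩ := S.exists_generic_mem hconv hFP hne
  have hmemF : ∀ y, y ∈ F ↔ y ∈ S.polytope ∧ ∀ z ∈ S.polytope, l z ≤ l y := fun y => by
    rw [hl]; rfl
  let I : Finset (Fin r) := Finset.univ.filter fun i => y₀ ⬝ᵥ intVec (S.ray i) = 1
  have hI : ∀ i, y₀ ⬝ᵥ intVec (S.ray i) = 1 ↔ i ∈ I := fun i => by simp [I]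
  obtain ⟨y, hyP, hyI, hyγ⟩ := hgap I ⟨y₀, hFP hy₀F, hI⟩
  -- Since y and y₀ lie on the same facets, the segment from y can be prolonged a little beyond y₀
  -- inside `P`; maximality of l at y₀ then forces l y ≥ l y₀.
  have hyF : y ∈ F := by
    refine (hmemF y).2 ⟨hyP, fun z hz => (((hmemF y₀).1 hy₀F).2 z hz).trans ?_⟩
    have hev : ∀ᶠ t : ℝ in nhdsWithin 0 (Set.Ioi 0), y₀ - t • (y - y₀) ∈ S.polytope := by
      refine Filter.eventually_all.2 fun i => ?_
      by_cases hi : i ∈ I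
      · refine Filter.Eventually.of_forall fun t => ?_
        rw [sub_dotProduct, smul_dotProduct, sub_dotProduct, (hI i).2 hi, (hyI i).2 hi]
        simp
      · have hlt : y₀ ⬝ᵥ intVec (S.ray i) < 1 :=
          lt_of_le_of_ne (hFP hy₀F i) fun h => hi ((hI i).1 h)
        have hc : Continuous fun t : ℝ => (y₀ - t • (y - y₀)) ⬝ᵥ intVec (S.ray i) :=
          (continuous_dotProduct_const _).comp (by fun_prop)
        have h := (hc.tendsto 0).mono_left (nhdsWithin_le_nhds (s := Set.Ioi 0))
        simp only [zero_smul, sub_zero] at h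
        exact (h.eventually (gt_mem_nhds hlt)).mono fun t ht => ht.le
    obtain ⟨t, ht, ht0⟩ := (hev.and self_mem_nhdsWithin).exists
    replace ht0 : 0 < t := ht0
    have h1 := ((hmemF y₀).1 hy₀F).2 _ ht
    rw [map_sub, map_smul, map_sub, smul_eq_mul] at h1
    have h2 : 0 ≤ t * (l y - l y₀) := by linarith
    linarith [nonneg_of_mul_nonneg_right h2 ht0]
  have hxlt : ∀ i ∉ I, x ⬝ᵥ intVec (S.ray i) < 1 := by
    intro i hi
    refine lt_of_le_of_ne (hFP hxF i) fun h1 => ?_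
    have hheight : S.height x = 1 :=
      le_antisymm (S.height_le_of_mem_polytope (hFP hxF)) (h1 ▸ S.le_height x i)
    have h2 := hneg x y hheight hyP i h1 (hyγ i hi)
    have h3 : 0 ≤ fderiv ℝ φ x (y - x) :=
      (hmin.localize).hasFDerivWithinAt_nonneg (hd x).hasFDerivAt.hasFDerivWithinAt
        (sub_mem_posTangentConeAt_of_segment_subset (hconv.segment_subset hxF hyF))
    linarith
  refine ⟨x, mem_intrinsicInterior.2 ⟨⟨x, subset_affineSpan ℝ F hxF⟩, ?_, rfl⟩, hmin⟩
  rw [mem_interior]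
  -- On the affine span of F the facets in I are equalities and l is constant, so only the
  -- inequalities off I must be kept, and these are strict at x.
  refine ⟨{z | ∀ i, i ∉ I → (z : Fin n → ℝ) ⬝ᵥ intVec (S.ray i) < 1}, fun z hz => ?_, ?_, hxlt⟩
  · have hzP : (z : Fin n → ℝ) ∈ S.polytope := fun i => by
      by_cases hi : i ∈ I
      · exact ((dotProductForm (intVec (S.ray i))).apply_eq_of_mem_affineSpan
          (hy₀ i ((hI i).2 hi)) z.2).le
      · exact (hz i hi).le
    have hlz : l z = l x := (l : (Fin n → ℝ) →ₗ[ℝ] ℝ).apply_eq_of_mem_affineSpan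
      (fun w hw => le_antisymm (((hmemF x).1 hxF).2 w (hFP hw)) (((hmemF w).1 hw).2 x (hFP hxF))) z.2
    refine (hmemF _).2 ⟨hzP, fun w hw => ?_⟩
    rw [hlz]
    exact ((hmemF x).1 hxF).2 w hw
  · simp only [Set.ofPred_forall]
    refine isOpen_iInter_of_finite fun i => isOpen_iInter_of_finite fun _ => ?_
    exact isOpen_lt ((continuous_dotProduct_const _).comp continuous_subtype_val) continuous_const

theorem le_dotProduct_of_mem_cone {s : Finset (Fin r)} {x u μ : Fin n → ℝ} (hx : x ∈ S.polytope)
    (hu : ∀ i ∈ s, u ⬝ᵥ intVec (S.ray i) = 1) (hμ : μ ∈ S.cone s) : 0 ≤ (u - x) ⬝ᵥ μ := by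
  obtain ⟨c, hc, rfl⟩ := hμ
  rw [S.dotProduct_sum_smul_ray]
  refine Finset.sum_nonneg fun i hi => mul_nonneg (hc i) ?_
  rw [sub_dotProduct, hu i hi]
  linarith [hx i]

theorem smul_mem_cone {s : Finset (Fin r)} {μ : Fin n → ℝ} (hμ : μ ∈ S.cone s) {t : ℝ}
    (ht : 0 ≤ t) : t • μ ∈ S.cone s := by
  obtain ⟨c, hc, rfl⟩ := hμ
  refine ⟨fun i => t * c i, fun i => mul_nonneg ht (hc i), ?_⟩
  rw [Finset.smul_sum]
  exact Finset.sum_congr rfl fun i _ => by rw [smul_smul]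

/-- A Fano fan has a potential such that, wherever the covector `dφ(x)` is close to a cone, all the
nearly maximal pairings `⟨x, bᵢ⟩` come from rays of that cone. -/
theorem exists_isPotential (hF : S.IsFano) :
    ∃ (δ : ℝ) (φ : (Fin n → ℝ) → ℝ), S.IsPotential φ ∧ IsStronglyConvexQuadratic δ φ ∧
      ∃ η > 0, ∃ κ > 0, ∀ s ∈ S.cones, ∀ x : Fin n → ℝ, x ≠ 0 → ∀ μ ∈ S.cone s,
        ‖-legendre φ x - μ‖ < κ * ‖legendre φ x‖ →
        ∀ i, (1 - η) * S.height x ≤ x ⬝ᵥ intVec (S.ray i) → i ∈ s := by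
  obtain ⟨γ, hγ0, hγ1, hgap⟩ := S.exists_polytope_gap
  obtain ⟨δ, φ, hφ, η, hη, κ, hκ, hneg⟩ := S.exists_potential_fderiv_le hγ0 hγ1
  refine ⟨δ, φ, ⟨hφ.continuous, hφ.convex, hφ.homogeneous, hφ.smooth,
    fun x hx v hv => hφ.hessian_pos hx hv, fun F hexp hne => ?_⟩, hφ, η, hη, ?_⟩
  · refine S.exists_isMinOn_intrinsicInterior hφ.differentiable hgap
      (fun x y hx hy i hi hyi => ?_) hexp hne.nonempty
    exact (hneg x y hx hy i (by linarith) hyi).trans_lt (by linarith)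
  obtain ⟨C, hC0, hC⟩ := S.exists_norm_le_of_mem_polytope
  obtain ⟨L, hL0, hL⟩ := hφ.exists_norm_legendre_le
  -- Here 2C bounds ‖u - x'‖ and L * C bounds the covector at the rescaled point x'; the added 1
  -- keeps the final inequality strict.
  refine ⟨κ / (n * (2 * C) * (L * C) + 1), by positivity, fun s hs x hx μ hμ hlt i hi => ?_⟩
  by_contra his
  obtain ⟨u₀, hu₀, hu₀s⟩ := S.exists_mem_polytope_eq_one_iff hF hs
  obtain ⟨u, huP, hus, huγ⟩ := hgap s ⟨u₀, hu₀, hu₀s⟩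
  have hh := S.height_pos hx
  have hh' : 0 < (S.height x)⁻¹ := inv_pos.2 hh
  set x' := (S.height x)⁻¹ • x with hx'
  have hheight : S.height x' = 1 := by
    rw [hx', S.height_smul hh'.le, inv_mul_cancel₀ hh.ne']
  have hxP : x' ∈ S.polytope := S.mem_polytope_of_height_le hheight.le
  have hi' : 1 - η ≤ x' ⬝ᵥ intVec (S.ray i) := by
    rw [hx', smul_dotProduct, smul_eq_mul, ← div_eq_inv_mul, le_div_iff₀ hh]
    exact hi
  have h1 := hneg x' u hheight huP i hi' (huγ i his)
  have h2 := S.le_dotProduct_of_mem_cone hxP (fun j hj => (hus j).2 hj)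
    (S.smul_mem_cone hμ hh'.le)
  rw [fderiv_apply_eq_neg_legendre, dotProduct_comm] at h1
  -- The covector pairs with u - x' to at most -κ, while μ in σ pairs nonnegatively, so they differ
  -- by a definite amount.
  have h3 : (u - x') ⬝ᵥ (-legendre φ x' - (S.height x)⁻¹ • μ) ≤ -κ := by
    rw [dotProduct_sub, dotProduct_neg]
    linarith
  have h4 := (abs_le.1 (abs_dotProduct_le (u - x') (-legendre φ x' - (S.height x)⁻¹ • μ))).1
  have h5 : -legendre φ x' - (S.height x)⁻¹ • μ = (S.height x)⁻¹ • (-legendre φ x - μ) := by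
    rw [hx', hφ.legendre_smul hh', smul_sub, smul_neg]
  have h6 : ‖-legendre φ x' - (S.height x)⁻¹ • μ‖ ≤
      κ / (n * (2 * C) * (L * C) + 1) * (L * C) := by
    have h7 : ‖legendre φ x'‖ ≤ L * C := (hL x').trans (by
      have := hC x' hxP
      gcongr)
    have h8 : ‖legendre φ x'‖ = (S.height x)⁻¹ * ‖legendre φ x‖ := by
      rw [hx', hφ.legendre_smul hh', norm_smul, Real.norm_eq_abs, abs_of_pos hh']
    rw [h5, norm_smul, Real.norm_eq_abs, abs_of_pos hh']
    calc (S.height x)⁻¹ * ‖-legendre φ x - μ‖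
        ≤ (S.height x)⁻¹ * (κ / (n * (2 * C) * (L * C) + 1) * ‖legendre φ x‖) := by gcongr
      _ = κ / (n * (2 * C) * (L * C) + 1) * ‖legendre φ x'‖ := by rw [h8]; ring
      _ ≤ _ := by gcongr
  have h9 : ‖u - x'‖ ≤ 2 * C := (norm_sub_le u x').trans (by
    have := hC u huP
    have := hC x' hxP
    linarith)
  have h10 : n * ‖u - x'‖ * ‖-legendre φ x' - (S.height x)⁻¹ • μ‖ ≤
      n * (2 * C) * (κ / (n * (2 * C) * (L * C) + 1) * (L * C)) := by gcongr
  have h11 : n * (2 * C) * (κ / (n * (2 * C) * (L * C) + 1) * (L * C)) < κ := by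
    have h12 : 0 ≤ n * (2 * C) * (L * C) := by positivity
    rw [show n * (2 * C) * (κ / (n * (2 * C) * (L * C) + 1) * (L * C)) =
      κ * (n * (2 * C) * (L * C)) / (n * (2 * C) * (L * C) + 1) by ring,
      div_lt_iff₀ (by positivity)]
    nlinarith
  linarith

end SmoothCompleteFan

/-! ### Characters of the torus -/

/-- The character `θ ↦ exp (2πi ⟨θ, a⟩)` of the torus. -/
noncomputable def torusChar {n : ℕ} (a : Fin n → ℤ) (θ : Torus n) : ℂ :=
  ∏ j, (AddCircle.toCircle (θ j) : ℂ) ^ a j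

theorem norm_torusChar {n : ℕ} (a : Fin n → ℤ) (θ : Torus n) : ‖torusChar a θ‖ = 1 := by
  simp [torusChar, norm_prod, norm_zpow, Circle.norm_coe]

theorem continuous_torusChar {n : ℕ} (a : Fin n → ℤ) : Continuous (torusChar (n := n) a) := by
  unfold torusChar
  refine continuous_finsetProd _ fun j _ => Continuous.zpow₀ ?_ _ fun θ => Or.inl ?_
  · exact continuous_subtype_val.comp (AddCircle.continuous_toCircle.comp (continuous_apply j))
  · exact Circle.coe_ne_zero _

theorem coe_toCircle_coe (t : ℝ) :
    ((AddCircle.toCircle (t : UnitAddCircle) : Circle) : ℂ) =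
      Complex.exp (2 * Real.pi * Complex.I * t) := by
  rw [AddCircle.toCircle_apply_mk, Circle.coe_exp]
  congr 1
  push_cast
  ring

theorem torusChar_torusMk {n : ℕ} (a : Fin n → ℤ) (u : Fin n → ℝ) :
    torusChar a (torusMk u) = Complex.exp (2 * Real.pi * Complex.I * (u ⬝ᵥ intVec a : ℝ)) := by
  simp only [torusChar, torusMk, coe_toCircle_coe, ← Complex.exp_int_mul]
  rw [← Complex.exp_sum]
  congr 1
  simp only [dotProduct, intVec, Complex.ofReal_sum, Complex.ofReal_mul, Complex.ofReal_intCast,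
    Finset.mul_sum]
  exact Finset.sum_congr rfl fun j _ => by ring

theorem prod_polar_zpow {n : ℕ} (a : Fin n → ℤ) (θ : Torus n) (ρ : Fin n → ℝ) :
    ∏ j, polar θ ρ j ^ a j = (Real.exp (ρ ⬝ᵥ intVec a) : ℂ) * torusChar a θ := by
  simp only [polar, mul_zpow, Finset.prod_mul_distrib, torusChar]
  congr 1
  simp only [← Complex.exp_int_mul, Complex.ofReal_exp]
  rw [← Complex.exp_sum]
  congr 1
  simp only [dotProduct, intVec, Complex.ofReal_sum, Complex.ofReal_mul, Complex.ofReal_intCast]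
  exact Finset.sum_congr rfl fun j _ => by ring

/-- The phase of the monomial is exp(i ∑ m_a arg q_a), and |e^{it} - 1| ≤ |t|. Only the arguments of
q enter, not their moduli. -/
theorem norm_prod_zpow_div_norm_sub_one_le {k : ℕ} (m : Fin k → ℤ) {q : Fin k → ℂ}
    (hq : ∀ a, q a ≠ 0) {ε : ℝ} (hε : ∀ a, |(q a).arg| ≤ ε) :
    ‖(∏ a, q a ^ m a) / ‖∏ a, q a ^ m a‖ - 1‖ ≤ (∑ a, |(m a : ℝ)|) * ε := by
  have h1 : ∏ a, q a ^ m a = (‖∏ a, q a ^ m a‖ : ℂ) *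
      Complex.exp (Complex.I * (∑ a, (m a : ℝ) * (q a).arg : ℝ)) := by
    rw [norm_prod]
    push_cast
    rw [Finset.mul_sum, Complex.exp_sum, ← Finset.prod_mul_distrib]
    refine Finset.prod_congr rfl fun a _ => ?_
    conv_lhs => rw [← Complex.norm_mul_exp_arg_mul_I (q a)]
    rw [mul_zpow, ← Complex.exp_int_mul, norm_zpow]
    push_cast
    congr 2
    ring
  have h2 : (‖∏ a, q a ^ m a‖ : ℂ) ≠ 0 := by
    rw [Complex.ofReal_ne_zero, norm_ne_zero_iff]
    exact Finset.prod_ne_zero_iff.2 fun a _ => zpow_ne_zero _ (hq a)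
  have h3 : (∏ a, q a ^ m a) / ‖∏ a, q a ^ m a‖ =
      Complex.exp (Complex.I * (∑ a, (m a : ℝ) * (q a).arg : ℝ)) := by
    rw [div_eq_iff h2, mul_comm]
    exact h1
  rw [h3]
  refine (Real.norm_exp_I_mul_ofReal_sub_one_le).trans ?_
  rw [Real.norm_eq_abs, Finset.sum_mul]
  refine (Finset.abs_sum_le_sum_abs _ _).trans (Finset.sum_le_sum fun a _ => ?_)
  rw [abs_mul]
  have := hε a
  gcongr

/-! ### Growth of the superpotential near the skeleton -/

theorem exists_le_mul_exp_sub {c D η : ℝ} (hc : 0 < c) (hη : 0 < η) :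
    ∃ C : ℝ, ∀ h : ℝ, 0 ≤ h → h - C ≤ c * Real.exp h - D * Real.exp ((1 - η) * h) := by
  let f : ℝ → ℝ := fun h => Real.exp h * (c - D * Real.exp (-(η * h)) - h * Real.exp (-h))
  have hf : ∀ h, f h = c * Real.exp h - D * Real.exp ((1 - η) * h) - h := fun h => by
    have h1 : Real.exp h * Real.exp (-(η * h)) = Real.exp ((1 - η) * h) := by
      rw [← Real.exp_add]; ring_nf
    have h2 : Real.exp h * Real.exp (-h) = 1 := by rw [← Real.exp_add]; simp
    simp only [f]
    linear_combination (-D) * h1 - h * h2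
  have hlim : Filter.Tendsto f Filter.atTop Filter.atTop := by
    have h1 : Filter.Tendsto (fun h : ℝ => Real.exp (-(η * h))) Filter.atTop (nhds 0) :=
      Real.tendsto_exp_neg_atTop_nhds_zero.comp (Filter.tendsto_id.const_mul_atTop hη)
    have h2 : Filter.Tendsto (fun h : ℝ => h * Real.exp (-h)) Filter.atTop (nhds 0) := by
      simpa using Real.tendsto_pow_mul_exp_neg_atTop_nhds_zero 1
    have h3 : Filter.Tendsto (fun h : ℝ => c - D * Real.exp (-(η * h)) - h * Real.exp (-h))
        Filter.atTop (nhds c) := by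
      simpa using (tendsto_const_nhds.sub (h1.const_mul D)).sub h2
    exact Real.tendsto_exp_atTop.atTop_mul_pos hc h3
  have hcont : Continuous f := by fun_prop
  obtain ⟨a, ha⟩ := (hlim.eventually_ge_atTop 0).exists_forall_of_atTop
  obtain ⟨C, hC⟩ := (isCompact_Icc (a := (0 : ℝ)) (b := a)).exists_bound_of_continuousOn
    hcont.continuousOn
  refine ⟨max C 0, fun h h0 => ?_⟩
  have h1 : -(max C 0) ≤ f h := by
    rcases le_total a h with hh | hh
    · exact (neg_nonpos.2 (le_max_right _ _)).trans (ha h hh)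
    · have := neg_abs_le (f h)
      have h2 := hC h ⟨h0, hh⟩
      rw [Real.norm_eq_abs] at h2
      linarith [le_max_left C 0]
  rw [hf] at h1
  linarith

namespace SmoothCompleteFan

variable {n r : ℕ} (S : SmoothCompleteFan n r)

/-- A conical neighbourhood of the skeleton: the covector is close to a cone `-σ` and the characters
given by the rays of `σ` are close to `1`. -/
def coneNhd (κ β : ℝ) : Set (Torus n × (Fin n → ℝ)) :=
  {y | y.2 ≠ 0 ∧ ∃ s ∈ S.cones, (∀ i ∈ s, ‖torusChar (S.ray i) y.1 - 1‖ < β) ∧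
    ∃ μ ∈ S.cone s, ‖-y.2 - μ‖ < κ * ‖y.2‖}

theorem ray_mem_cone {s : Finset (Fin r)} {i : Fin r} (hi : i ∈ s) :
    intVec (S.ray i) ∈ S.cone s := by
  classical
  refine ⟨Pi.single i 1, fun j => ?_, ?_⟩
  · by_cases h : j = i
    · subst h; simp
    · simp [h]
  · rw [Finset.sum_eq_single_of_mem i hi fun j _ hj => by simp [hj]]
    simp

theorem isConicalNhd_coneNhd {κ β : ℝ} (hκ : 0 < κ) (hβ : 0 < β) :
    S.IsConicalNhd (S.coneNhd κ β) := by
  refine ⟨?_, fun y hy => hy.1, ?_, ?_⟩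
  · have : S.coneNhd κ β = {y | y.2 ≠ 0} ∩ ⋃ s ∈ S.cones,
        ((⋂ i ∈ s, {y | ‖torusChar (S.ray i) y.1 - 1‖ < β}) ∩
          ⋃ μ ∈ S.cone s, {y | ‖-y.2 - μ‖ < κ * ‖y.2‖}) := by
      ext y
      simp [coneNhd, and_left_comm]
    rw [this]
    refine (isOpen_ne_fun continuous_snd continuous_const).inter
      (isOpen_biUnion fun s _ => IsOpen.inter ?_ (isOpen_biUnion fun μ _ => ?_))
    · refine isOpen_biInter_finset fun i _ => isOpen_lt ?_ continuous_const
      exact (((continuous_torusChar _).comp continuous_fst).sub continuous_const).norm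
    · exact isOpen_lt (by fun_prop) (by fun_prop)
  · rintro y ⟨hy, s, hs, hχ, μ, hμ, hlt⟩ t ht
    refine ⟨smul_ne_zero ht.ne' hy, s, hs, hχ, t • μ, S.smul_mem_cone hμ ht.le, ?_⟩
    rw [← smul_neg, ← smul_sub, norm_smul, norm_smul, Real.norm_eq_abs, abs_of_pos ht]
    nlinarith
  · intro y hy hy0
    simp only [skeleton, Set.mem_iUnion] at hy
    obtain ⟨s, hs, ⟨u, hu, hyu⟩, hy2⟩ := hy
    refine ⟨hy0, s, hs, fun i hi => ?_, -y.2, hy2, ?_⟩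
    -- On the skeleton itself the characters of σ equal 1 and the covector is exactly in -σ.
    · rw [hyu, torusChar_torusMk, hu _ (S.ray_mem_cone hi)]
      simpa using hβ
    · rw [sub_self, norm_zero]
      exact mul_pos hκ (norm_pos_iff.2 hy0)

/-- The Laurent polynomial `∑ᵢ cᵢ Y^{bᵢ}`. -/
noncomputable def laurent (c : Fin r → ℂ) (Y : Fin n → ℂ) : ℂ :=
  ∑ i, c i * ∏ j, Y j ^ S.ray i j

theorem re_laurent_polar_mul (c : Fin r → ℂ) (hc : ∀ i, c i ≠ 0) (θ : Torus n) (ρ : Fin n → ℝ)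
    (ζ : ℂ) : (S.laurent c (polar θ ρ) * ζ).re = ∑ i, ‖c i‖ * Real.exp (ρ ⬝ᵥ intVec (S.ray i)) *
      (c i / ‖c i‖ * torusChar (S.ray i) θ * ζ).re := by
  rw [laurent, Finset.sum_mul, Complex.re_sum]
  refine Finset.sum_congr rfl fun i _ => ?_
  rw [prod_polar_zpow, ← Complex.re_ofReal_mul]
  have : (‖c i‖ : ℂ) ≠ 0 := by simpa using hc i
  congr 1
  push_cast
  field_simp

/-- Terms with pairing at least (1 - η)h come from rays of σ, so their phases are near 1 and they
contribute positively; one of them has modulus ‖c_i‖ exp h. All other terms are bounded by exp((1 -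
η)h), which loses. The constant C is independent of ζ. -/
theorem exists_growth {δ : ℝ} {φ : (Fin n → ℝ) → ℝ} (hφ : IsStronglyConvexQuadratic δ φ)
    {η κ : ℝ} (hη : 0 < η)
    (hnear : ∀ s ∈ S.cones, ∀ x : Fin n → ℝ, x ≠ 0 → ∀ μ ∈ S.cone s,
      ‖-legendre φ x - μ‖ < κ * ‖legendre φ x‖ →
      ∀ i, (1 - η) * S.height x ≤ x ⬝ᵥ intVec (S.ray i) → i ∈ s)
    {c : Fin r → ℂ} (hc : ∀ i, c i ≠ 0) {σ : ℝ} (hσ : 0 < σ)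
    (hcσ : ∀ i, ‖c i / ‖c i‖ - 1‖ ≤ σ / 4) :
    ∃ C : ℝ, ∀ (θ : Torus n) (ρ : Fin n → ℝ), (θ, legendre φ ρ) ∈ S.coneNhd κ (σ / 4) →
      ∀ ζ : ℂ, ‖ζ‖ = 1 → σ ≤ ζ.re → S.height ρ - C ≤ (S.laurent c (polar θ ρ) * ζ).re := by
  have hex : ∀ i, ∃ C : ℝ, ∀ h : ℝ, 0 ≤ h → h - C ≤
      ‖c i‖ * (σ / 2) * Real.exp h - (∑ i, ‖c i‖) * Real.exp ((1 - η) * h) := fun i =>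
    exists_le_mul_exp_sub (by have := norm_pos_iff.2 (hc i); positivity) hη
  choose C hC using hex
  refine ⟨∑ i, |C i|, fun θ ρ hmem ζ hζ hζre => ?_⟩
  obtain ⟨hξ, s, hs, hχ, μ, hμ, hlt⟩ := hmem
  have hρ : ρ ≠ 0 := by
    rintro rfl
    exact hξ hφ.legendre_zero
  have hh := S.height_pos hρ
  obtain ⟨i₀, hi₀⟩ := S.exists_eq_height hρ
  have hunit : ∀ i, ‖c i / ‖c i‖ * torusChar (S.ray i) θ‖ = 1 := fun i => by
    rw [norm_mul, norm_torusChar, norm_div, Complex.norm_real, norm_norm,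
      div_self (norm_ne_zero_iff.2 (hc i)), mul_one]
  have hnr : ∀ i, (1 - η) * S.height ρ ≤ ρ ⬝ᵥ intVec (S.ray i) →
      σ / 2 ≤ (c i / ‖c i‖ * torusChar (S.ray i) θ * ζ).re := fun i hi => by
    have h1 := hχ i (hnear s hs ρ hρ μ hμ hlt i hi)
    -- Coefficient and character each cost σ/4, which leaves Re ≥ σ - σ/2 after multiplication by ζ.
    have h2 : ‖c i / ‖c i‖ * torusChar (S.ray i) θ - 1‖ ≤ σ / 2 := by
      have h3 : c i / ‖c i‖ * torusChar (S.ray i) θ - 1 =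
          (c i / ‖c i‖ - 1) * torusChar (S.ray i) θ + (torusChar (S.ray i) θ - 1) := by ring
      rw [h3]
      refine (norm_add_le _ _).trans ?_
      rw [norm_mul, norm_torusChar, mul_one]
      have := hcσ i
      simp only at h1
      linarith
    have h4 : ‖(c i / ‖c i‖ * torusChar (S.ray i) θ - 1) * ζ‖ ≤ σ / 2 := by
      rwa [norm_mul, hζ, mul_one]
    have h5 := (abs_le.1 (Complex.abs_re_le_norm
      ((c i / ‖c i‖ * torusChar (S.ray i) θ - 1) * ζ))).1
    have h6 : (c i / ‖c i‖ * torusChar (S.ray i) θ * ζ).re =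
        ((c i / ‖c i‖ * torusChar (S.ray i) θ - 1) * ζ).re + ζ.re := by
      rw [← Complex.add_re]
      congr 1
      ring
    rw [h6]
    linarith
  rw [S.re_laurent_polar_mul c hc]
  have hterm : ∀ i, (if i = i₀ then ‖c i‖ * (σ / 2) * Real.exp (S.height ρ) else 0) -
      ‖c i‖ * Real.exp ((1 - η) * S.height ρ) ≤ ‖c i‖ * Real.exp (ρ ⬝ᵥ intVec (S.ray i)) *
      (c i / ‖c i‖ * torusChar (S.ray i) θ * ζ).re := fun i => by
    have h0 : 0 ≤ ‖c i‖ * Real.exp ((1 - η) * S.height ρ) := by positivity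
    by_cases hi : (1 - η) * S.height ρ ≤ ρ ⬝ᵥ intVec (S.ray i)
    · have h1 : ‖c i‖ * Real.exp (ρ ⬝ᵥ intVec (S.ray i)) * (σ / 2) ≤
          ‖c i‖ * Real.exp (ρ ⬝ᵥ intVec (S.ray i)) *
            (c i / ‖c i‖ * torusChar (S.ray i) θ * ζ).re := by
        have := hnr i hi
        gcongr
      split_ifs with hii
      · subst hii
        rw [hi₀] at h1 ⊢
        linarith
      · have : 0 ≤ ‖c i‖ * Real.exp (ρ ⬝ᵥ intVec (S.ray i)) * (σ / 2) := by positivity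
        linarith
    · have hii : i ≠ i₀ := by
        rintro rfl
        rw [hi₀] at hi
        exact hi (by nlinarith)
      rw [if_neg hii, zero_sub]
      have h1 := (abs_le.1 (Complex.abs_re_le_norm
        (c i / ‖c i‖ * torusChar (S.ray i) θ * ζ))).1
      rw [norm_mul, hunit, hζ, one_mul] at h1
      have h2 : Real.exp (ρ ⬝ᵥ intVec (S.ray i)) ≤ Real.exp ((1 - η) * S.height ρ) :=
        Real.exp_le_exp.2 (not_le.1 hi).le
      have h3 : ‖c i‖ * Real.exp (ρ ⬝ᵥ intVec (S.ray i)) ≤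
          ‖c i‖ * Real.exp ((1 - η) * S.height ρ) := by gcongr
      have h4 : 0 ≤ ‖c i‖ * Real.exp (ρ ⬝ᵥ intVec (S.ray i)) := by positivity
      nlinarith
  refine le_trans ?_ (Finset.sum_le_sum fun i _ => hterm i)
  rw [Finset.sum_sub_distrib, Finset.sum_ite_eq', if_pos (Finset.mem_univ _), ← Finset.sum_mul]
  have h1 := hC i₀ (S.height ρ) hh.le
  have h2 : C i₀ ≤ ∑ i, |C i| := (le_abs_self _).trans
    (Finset.single_le_sum (f := fun i => |C i|) (fun _ _ => abs_nonneg _) (Finset.mem_univ i₀))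
  linarith

end SmoothCompleteFan

/-- Test with the extreme rotations by ±(π/2 - ε): an argument of size at least ε would be carried
into the left half plane. -/
theorem Complex.abs_arg_lt_of_re_mul_pos {w : ℂ} {ε : ℝ} (hε0 : 0 < ε) (hε : ε < Real.pi / 2)
    (h : ∀ ζ : ℂ, ‖ζ‖ = 1 → Real.sin ε ≤ ζ.re → 0 < (w * ζ).re) : w ≠ 0 ∧ |w.arg| < ε := by
  have hw : w ≠ 0 := by
    rintro rfl
    simpa using h 1 (by simp) (by simpa using Real.sin_le_one ε)
  have key : ∀ τ : ℝ, |τ| = Real.pi / 2 - ε → 0 < Real.cos (w.arg + τ) := fun τ hτ => by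
    have h1 := h (Complex.exp (τ * Complex.I)) (Complex.norm_exp_ofReal_mul_I τ) (by
      rw [Complex.exp_ofReal_mul_I_re, ← Real.cos_abs, hτ, Real.cos_pi_div_two_sub])
    have h2 : w * Complex.exp (τ * Complex.I) =
        (‖w‖ : ℂ) * Complex.exp ((w.arg + τ : ℝ) * Complex.I) := by
      conv_lhs => rw [← Complex.norm_mul_exp_arg_mul_I w]
      rw [mul_assoc, ← Complex.exp_add]
      push_cast
      ring_nf
    rw [h2, Complex.re_ofReal_mul, Complex.exp_ofReal_mul_I_re] at h1
    exact (pos_iff_pos_of_mul_pos h1).1 (norm_pos_iff.2 hw)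
  refine ⟨hw, abs_lt.2 ⟨?_, ?_⟩⟩
  · by_contra! hle
    have h1 := key (-(Real.pi / 2 - ε)) (by rw [abs_neg, abs_of_pos (by linarith)])
    rw [← Real.cos_neg] at h1
    exact absurd h1 (not_lt.2 (Real.cos_nonpos_of_pi_div_two_le_of_le (by linarith)
      (by linarith [Complex.neg_pi_lt_arg w])))
  · by_contra! hle
    have h1 := key (Real.pi / 2 - ε) (abs_of_pos (by linarith))
    exact absurd h1 (not_lt.2 (Real.cos_nonpos_of_pi_div_two_le_of_le (by linarith)
      (by linarith [Complex.arg_le_pi w])))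

theorem LinearMap.volume_level_eq_zero {n : ℕ} {f : (Fin n → ℝ) →ₗ[ℝ] ℝ} (hf : f ≠ 0) (m : ℝ) :
    volume {x | f x = m} = 0 := by
  rcases {x | f x = m}.eq_empty_or_nonempty with h | ⟨x₀, hx₀⟩
  · rw [h, measure_empty]
  have h1 : {x | f x = m} = AffineSubspace.mk' x₀ (LinearMap.ker f) := by
    ext x
    have hx₀' : f x₀ = m := hx₀
    simp [AffineSubspace.mem_mk', sub_eq_zero, hx₀']
  rw [h1]
  refine Measure.addHaar_affineSubspace _ _ fun htop => hf ?_
  have := congrArg AffineSubspace.direction htop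
  rwa [AffineSubspace.direction_mk', AffineSubspace.direction_top, LinearMap.ker_eq_top] at this

theorem exists_intVec_sub_of_torusMk_eq {n : ℕ} {u v : Fin n → ℝ} (h : torusMk u = torusMk v) :
    ∃ a : Fin n → ℤ, u - v = intVec a := by
  have : ∀ j, ∃ m : ℤ, u j - v j = m := fun j => by
    have h1 := congrFun h j
    simp only [torusMk] at h1
    obtain ⟨m, hm⟩ := (QuotientAddGroup.eq_iff_sub_mem.1 h1)
    exact ⟨m, by simpa using hm.symm⟩
  choose a ha using this
  exact ⟨a, funext ha⟩

theorem intVec_dotProduct_intVec {n : ℕ} (a b : Fin n → ℤ) :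
    intVec a ⬝ᵥ intVec b = ((a ⬝ᵥ b : ℤ) : ℝ) := by
  simp [dotProduct, intVec]

theorem continuous_torusMk (n : ℕ) : Continuous (torusMk (n := n)) :=
  continuous_pi fun j => (AddCircle.continuous_mk' 1).comp (continuous_apply j)

/-! ### Charts of the skeleton -/

namespace SmoothCompleteFan

variable {n r : ℕ} (S : SmoothCompleteFan n r)

theorem zero_mem_cone (s : Finset (Fin r)) : (0 : Fin n → ℝ) ∈ S.cone s :=
  ⟨0, fun _ => le_rfl, by simp⟩

theorem add_mem_cone {s : Finset (Fin r)} {v w : Fin n → ℝ} (hv : v ∈ S.cone s)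
    (hw : w ∈ S.cone s) : v + w ∈ S.cone s := by
  obtain ⟨c, hc, rfl⟩ := hv
  obtain ⟨d, hd, rfl⟩ := hw
  refine ⟨c + d, fun i => add_nonneg (hc i) (hd i), ?_⟩
  rw [← Finset.sum_add_distrib]
  exact Finset.sum_congr rfl fun i _ => by rw [Pi.add_apply, add_smul]

theorem sum_mem_cone {s : Finset (Fin r)} {ι : Type*} (I : Finset ι) {f : ι → Fin n → ℝ}
    (h : ∀ i ∈ I, f i ∈ S.cone s) : ∑ i ∈ I, f i ∈ S.cone s :=
  Finset.sum_induction _ (· ∈ S.cone s) (fun _ _ => S.add_mem_cone) (S.zero_mem_cone s) h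

section frame

variable {S} {s : Finset (Fin r)} {c : Fin n → Fin r}

theorem IsFrame.dualFrame_dotProduct (hc : S.IsFrame s c) (j i : Fin n) :
    S.dualFrame c j ⬝ᵥ intVec (S.ray (c i)) = if i = j then 1 else 0 := by
  set B : Matrix (Fin n) (Fin n) ℝ := Matrix.of fun i => intVec (S.ray (c i)) with hB
  have hli : LinearIndependent ℝ B.row := by
    have h1 := (S.simplicial _ hc.2.1).comp
      (fun i : Fin n => (⟨c i, by simp⟩ : (Finset.univ.image c : Finset (Fin r))))
      (fun i k h => hc.1 (Subtype.ext_iff.1 h))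
    exact h1
  have hu : IsUnit B.det := (Matrix.isUnit_iff_isUnit_det B).1
    (Matrix.linearIndependent_rows_iff_isUnit.1 hli)
  have h2 := congrFun (congrFun (Matrix.mul_nonsing_inv B hu) i) j
  rw [Matrix.mul_apply, Matrix.one_apply] at h2
  rw [dotProduct_comm]
  exact h2

theorem IsFrame.exists_eq (hc : S.IsFrame s c) {i : Fin r} (hi : i ∈ s) : ∃ j, c j = i := by
  simpa using hc.2.2 hi

theorem IsFrame.mem_cones (hc : S.IsFrame s c) : s ∈ S.cones :=
  S.face_mem _ hc.2.1 _ hc.2.2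

theorem chartAngle_dotProduct (x : Fin n → ℝ) (w : Fin n → ℝ) :
    S.chartAngle s c x ⬝ᵥ w = ∑ j, if c j ∈ s then 0 else x j * (S.dualFrame c j ⬝ᵥ w) := by
  rw [chartAngle, sum_dotProduct]
  refine Finset.sum_congr rfl fun j _ => ?_
  split_ifs <;> simp

theorem IsFrame.chartAngle_dotProduct_ray (hc : S.IsFrame s c) (x : Fin n → ℝ) {i : Fin r}
    (hi : i ∈ s) : S.chartAngle s c x ⬝ᵥ intVec (S.ray i) = 0 := by
  obtain ⟨k, rfl⟩ := hc.exists_eq hi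
  rw [chartAngle_dotProduct]
  refine Finset.sum_eq_zero fun j _ => ?_
  split_ifs with h
  · rfl
  · rw [hc.dualFrame_dotProduct, if_neg, mul_zero]
    rintro rfl
    exact h hi

theorem IsFrame.chartAngle_dotProduct_of_mem_cone (hc : S.IsFrame s c) (x : Fin n → ℝ)
    {v : Fin n → ℝ} (hv : v ∈ S.cone s) : S.chartAngle s c x ⬝ᵥ v = 0 := by
  obtain ⟨d, -, rfl⟩ := hv
  rw [S.dotProduct_sum_smul_ray]
  exact Finset.sum_eq_zero fun i hi => by rw [hc.chartAngle_dotProduct_ray x hi, mul_zero]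

theorem neg_chartMomentum_mem_cone {x : Fin n → ℝ} (hx : ∀ j, c j ∈ s → 0 ≤ x j) :
    -S.chartMomentum s c x ∈ S.cone s := by
  rw [chartMomentum, neg_neg]
  refine S.sum_mem_cone _ fun j _ => ?_
  split_ifs with h
  · exact S.smul_mem_cone (S.ray_mem_cone h) (hx j h)
  · exact S.zero_mem_cone s

theorem IsFrame.dualFrame_dotProduct_neg_chartMomentum (hc : S.IsFrame s c) (x : Fin n → ℝ)
    (j : Fin n) :
    S.dualFrame c j ⬝ᵥ -S.chartMomentum s c x = if c j ∈ s then x j else 0 := by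
  rw [chartMomentum, neg_neg, dotProduct_sum, Finset.sum_eq_single_of_mem j (Finset.mem_univ j)]
  · split_ifs <;> simp [dotProduct_smul, hc.dualFrame_dotProduct]
  · intro i _ hij
    split_ifs <;> simp [dotProduct_smul, hc.dualFrame_dotProduct, hij]

theorem IsFrame.mem_skeletonPiece (hc : S.IsFrame s c) {x : Fin n → ℝ}
    (hx : ∀ j, c j ∈ s → 0 ≤ x j) :
    (torusMk (S.chartAngle s c x), S.chartMomentum s c x) ∈ S.skeletonPiece s :=
  ⟨⟨_, fun _ hv => hc.chartAngle_dotProduct_of_mem_cone x hv, rfl⟩, neg_chartMomentum_mem_cone hx⟩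

/-- A momentum in the relative interior of -σ lies only in pieces of cones t ⊇ s. If t had a further
ray, the angle would pair integrally with it. -/
theorem IsFrame.mem_smoothLocus (hc : S.IsFrame s c) {x : Fin n → ℝ}
    (hx : ∀ j, c j ∈ s → 0 < x j)
    (hint : ∀ i ∉ s, insert i s ∈ S.cones →
      ∀ m : ℤ, S.chartAngle s c x ⬝ᵥ intVec (S.ray i) ≠ m) :
    (torusMk (S.chartAngle s c x), S.chartMomentum s c x) ∈ S.smoothLocus := by
  refine ⟨s, ⟨hc.mem_cones, hc.mem_skeletonPiece fun j hj => (hx j hj).le⟩, ?_⟩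
  rintro t ⟨ht, ⟨u, hu, hxu⟩, hmom⟩
  have hst : s ⊆ t := by
    intro i hi
    obtain ⟨j, rfl⟩ := hc.exists_eq hi
    by_contra hit
    have h1 : -S.chartMomentum s c x ∈ S.cone s ∩ S.cone t :=
      ⟨neg_chartMomentum_mem_cone fun j hj => (hx j hj).le, hmom⟩
    rw [cone, cone, S.inter_eq s hc.mem_cones t ht] at h1
    obtain ⟨d, -, hd⟩ := h1
    have h2 := hc.dualFrame_dotProduct_neg_chartMomentum x j
    rw [hd, S.dotProduct_sum_smul_ray, if_pos hi, Finset.sum_eq_zero] at h2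
    · exact (hx j hi).ne h2
    · intro k hk
      rw [Finset.mem_inter] at hk
      obtain ⟨l, rfl⟩ := hc.exists_eq hk.1
      rw [hc.dualFrame_dotProduct, if_neg, mul_zero]
      rintro rfl
      exact hit hk.2
  refine (hst.antisymm fun i hi => ?_).symm
  by_contra his
  obtain ⟨a, ha⟩ := exists_intVec_sub_of_torusMk_eq hxu
  refine hint i his (S.face_mem t ht _ (Finset.insert_subset hi hst)) (a ⬝ᵥ S.ray i) ?_
  rw [← intVec_dotProduct_intVec, ← ha, sub_dotProduct, hu _ (S.ray_mem_cone hi), sub_zero]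

/-! ### Multiplicities on a chart -/

variable (S s c) in
/-- The part of the chart of `Λ_σ` on which the pairings of the angle with the rays adjacent to `σ`
have given integral parts and are not integral. -/
def chartCell (f : Fin r → ℤ) : Set (Fin n → ℝ) :=
  {x | (∀ j, c j ∈ s → 0 < x j) ∧ ∀ i, i ∉ s → insert i s ∈ S.cones →
    (f i : ℝ) < S.chartAngle s c x ⬝ᵥ intVec (S.ray i) ∧
      S.chartAngle s c x ⬝ᵥ intVec (S.ray i) < f i + 1}

variable (S s c) in
/-- The angle of the chart as a linear map. -/
noncomputable def chartAngleL : (Fin n → ℝ) →L[ℝ] (Fin n → ℝ) :=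
  ∑ j, if c j ∈ s then 0 else
    (ContinuousLinearMap.proj (R := ℝ) (φ := fun _ : Fin n => ℝ) j).smulRight (S.dualFrame c j)

theorem chartAngleL_apply (x : Fin n → ℝ) : chartAngleL S s c x = S.chartAngle s c x := by
  rw [chartAngleL, chartAngle, sum_apply]
  refine Finset.sum_congr rfl fun j _ => ?_
  split_ifs <;> simp

variable (S s c) in
/-- The momentum of the chart as a linear map. -/
noncomputable def chartMomentumL : (Fin n → ℝ) →L[ℝ] (Fin n → ℝ) :=
  -∑ j, if c j ∈ s then
    (ContinuousLinearMap.proj (R := ℝ) (φ := fun _ : Fin n => ℝ) j).smulRight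
      (intVec (S.ray (c j))) else 0

theorem chartMomentumL_apply (x : Fin n → ℝ) :
    chartMomentumL S s c x = S.chartMomentum s c x := by
  rw [chartMomentumL, chartMomentum, neg_apply, sum_apply]
  congr 1
  refine Finset.sum_congr rfl fun j _ => ?_
  split_ifs <;> simp

theorem continuous_chartAngle : Continuous (S.chartAngle s c) := by
  rw [← funext (chartAngleL_apply (S := S) (s := s) (c := c))]
  exact (chartAngleL S s c).continuous

theorem continuous_chartMomentum : Continuous (S.chartMomentum s c) := by
  rw [← funext (chartMomentumL_apply (S := S) (s := s) (c := c))]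
  exact (chartMomentumL S s c).continuous

theorem continuous_chartAngle_dotProduct (w : Fin n → ℝ) :
    Continuous fun x => S.chartAngle s c x ⬝ᵥ w :=
  (continuous_dotProduct_const w).comp continuous_chartAngle

theorem chartAngle_convexComb (x y : Fin n → ℝ) (a b : ℝ) :
    S.chartAngle s c (a • x + b • y) = a • S.chartAngle s c x + b • S.chartAngle s c y := by
  simp only [← chartAngleL_apply, map_add, map_smul]

theorem convex_chartCell (f : Fin r → ℤ) : Convex ℝ (S.chartCell s c f) := by
  intro x hx y hy a b ha hb hab
  refine ⟨fun j hj => ?_, fun i hi hmem => ?_⟩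
  · exact convex_Ioi (0 : ℝ) (hx.1 j hj) (hy.1 j hj) ha hb hab
  · have := convex_Ioo (𝕜 := ℝ) (f i : ℝ) (f i + 1) (hx.2 i hi hmem) (hy.2 i hi hmem) ha hb hab
    rw [chartAngle_convexComb, add_dotProduct, smul_dotProduct, smul_dotProduct]
    exact this

theorem measurableSet_chartCell (f : Fin r → ℤ) : MeasurableSet (S.chartCell s c f) := by
  simp only [chartCell, Set.ofPred_and, Set.ofPred_forall]
  refine MeasurableSet.inter (MeasurableSet.iInter fun j => MeasurableSet.iInter fun _ => ?_)
    (MeasurableSet.iInter fun i => MeasurableSet.iInter fun _ => MeasurableSet.iInter fun _ => ?_)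
  · exact (isOpen_lt continuous_const (continuous_apply j)).measurableSet
  · exact ((isOpen_lt continuous_const (continuous_chartAngle_dotProduct _)).inter
      (isOpen_lt (continuous_chartAngle_dotProduct _) continuous_const)).measurableSet

theorem IsFrame.mem_smoothLocus_of_mem_chartCell (hc : S.IsFrame s c) {f : Fin r → ℤ}
    {x : Fin n → ℝ} (hx : x ∈ S.chartCell s c f) :
    (torusMk (S.chartAngle s c x), S.chartMomentum s c x) ∈ S.smoothLocus := by
  refine hc.mem_smoothLocus hx.1 fun i hi hmem m hm => ?_
  have h1 := hx.2 i hi hmem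
  rw [hm] at h1
  have h2 : f i < m := by exact_mod_cast h1.1
  have h3 : m < f i + 1 := by exact_mod_cast h1.2
  omega

variable (S) in
-- The base point at which the microlocal stalk is taken is chosen from the component as a set, so
-- no invariance theorem for microlocal stalks is needed.
theorem ccMultiplicity_eq_of_connectedComponentIn_eq (F : TorusD n)
    {y y' : Torus n × (Fin n → ℝ)} (hy : y ∈ S.smoothLocus)
    (h : connectedComponentIn S.smoothLocus y = connectedComponentIn S.smoothLocus y') :
    S.ccMultiplicity F y = S.ccMultiplicity F y' := by
  have hy' : y' ∈ S.smoothLocus := by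
    rw [← connectedComponentIn_nonempty_iff, ← h, connectedComponentIn_nonempty_iff]
    exact hy
  have key : ∀ (A B : Set (Torus n × (Fin n → ℝ))) (hA : A.Nonempty) (hB : B.Nonempty), A = B →
      hA.some = hB.some := by
    rintro A _ hA hB rfl
    rfl
  rw [ccMultiplicity, ccMultiplicity, dif_pos hy, dif_pos hy']
  exact congrArg _ (key _ _ _ _ h)

theorem IsFrame.ccMultiplicity_eq_of_mem_chartCell (hc : S.IsFrame s c) (F : TorusD n)
    {f : Fin r → ℤ} {x y : Fin n → ℝ} (hx : x ∈ S.chartCell s c f) (hy : y ∈ S.chartCell s c f) :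
    S.ccMultiplicity F (torusMk (S.chartAngle s c x), S.chartMomentum s c x) =
      S.ccMultiplicity F (torusMk (S.chartAngle s c y), S.chartMomentum s c y) := by
  refine S.ccMultiplicity_eq_of_connectedComponentIn_eq F
    (hc.mem_smoothLocus_of_mem_chartCell hx) (connectedComponentIn_eq ?_)
  have hcont : Continuous fun x => (torusMk (S.chartAngle s c x), S.chartMomentum s c x) :=
    ((continuous_torusMk n).comp continuous_chartAngle).prodMk continuous_chartMomentum
  -- A cell is convex, so its image in the smooth locus stays in one component.
  have hpre := (convex_chartCell (S := S) (s := s) (c := c) f).isPreconnected.image _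
    hcont.continuousOn
  refine hpre.subset_connectedComponentIn (Set.mem_image_of_mem _ hx) ?_ (Set.mem_image_of_mem _ hy)
  rintro _ ⟨w, hw, rfl⟩
  exact hc.mem_smoothLocus_of_mem_chartCell hw

/-- The pairing is a nonzero linear form in the chart: because σ and b_i span a cone, some v in σ^⊥
pairs to 1 with b_i, and v is the angle of the point w with coordinates ⟨v, b_{c j}⟩. -/
theorem IsFrame.volume_chartAngle_integral_eq_zero (hc : S.IsFrame s c) {i : Fin r} (hi : i ∉ s)
    (his : insert i s ∈ S.cones) (m : ℝ) :
    volume {x | S.chartAngle s c x ⬝ᵥ intVec (S.ray i) = m} = 0 := by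
  have hf : (dotProductForm (intVec (S.ray i))).comp
      (chartAngleL S s c : (Fin n → ℝ) →ₗ[ℝ] (Fin n → ℝ)) ≠ 0 := by
    intro h0
    obtain ⟨v, hv⟩ := S.exists_dotProduct_eq his (Pi.single i 1)
    have hvs : ∀ k ∈ s, v ⬝ᵥ intVec (S.ray k) = 0 := fun k hk => by
      rw [hv k (Finset.mem_insert_of_mem hk), Pi.single_eq_of_ne]
      rintro rfl
      exact hi hk
    have hvi : v ⬝ᵥ intVec (S.ray i) = 1 := by
      rw [hv i (Finset.mem_insert_self i s), Pi.single_eq_same]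
    let w : Fin n → ℝ := fun j => v ⬝ᵥ intVec (S.ray (c j))
    have hw : S.chartAngle s c w = v := by
      set B : Matrix (Fin n) (Fin n) ℝ := Matrix.of fun i => intVec (S.ray (c i)) with hB
      have hinj : Function.Injective B.mulVec := by
        rw [Matrix.mulVec_injective_iff_isUnit]
        refine Matrix.linearIndependent_rows_iff_isUnit.1 ?_
        exact (S.simplicial _ hc.2.1).comp
          (fun i : Fin n => (⟨c i, by simp⟩ : (Finset.univ.image c : Finset (Fin r))))
          (fun i k h => hc.1 (Subtype.ext_iff.1 h))
      refine hinj (funext fun k => ?_)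
      have h1 : ∀ z : Fin n → ℝ, B.mulVec z k = z ⬝ᵥ intVec (S.ray (c k)) := fun z => by
        rw [Matrix.mulVec, dotProduct_comm]
        rfl
      rw [h1, h1, chartAngle_dotProduct, Finset.sum_eq_single_of_mem k (Finset.mem_univ k)]
      · split_ifs with hk
        · exact (hvs _ hk).symm
        · rw [hc.dualFrame_dotProduct, if_pos rfl, mul_one]
      · intro j _ hjk
        rw [hc.dualFrame_dotProduct, if_neg hjk.symm, mul_zero, ite_self]
    have h2 := LinearMap.congr_fun h0 w
    simp only [LinearMap.comp_apply, ContinuousLinearMap.coe_coe, chartAngleL_apply, hw,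
      LinearMap.zero_apply] at h2
    have h3 : v ⬝ᵥ intVec (S.ray i) = 0 := h2
    linarith
  have := LinearMap.volume_level_eq_zero hf m
  simp only [LinearMap.comp_apply, ContinuousLinearMap.coe_coe, chartAngleL_apply] at this
  exact this

theorem measurableSet_chartDomain : MeasurableSet (chartDomain s c) := by
  simp only [chartDomain, Set.ofPred_forall, Set.ofPred_and]
  refine MeasurableSet.iInter fun j => MeasurableSet.inter (MeasurableSet.iInter fun _ => ?_)
    (MeasurableSet.iInter fun _ => MeasurableSet.inter ?_ ?_)
  · exact (isOpen_lt continuous_const (continuous_apply j)).measurableSet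
  · exact (isClosed_le continuous_const (continuous_apply j)).measurableSet
  · exact (isOpen_lt (continuous_apply j) continuous_const).measurableSet

/-- Angular coordinates lie in [0, 1), so each pairing is bounded and its integral part takes
finitely many values. -/
theorem exists_finset_chartDomain_subset : ∃ A : Finset (Fin r → ℤ), chartDomain s c ⊆
    (⋃ f ∈ A, S.chartCell s c f) ∪ ⋃ i ∈ {i | i ∉ s ∧ insert i s ∈ S.cones}, ⋃ m : ℤ,
      {x | S.chartAngle s c x ⬝ᵥ intVec (S.ray i) = m} := by
  let B : Fin r → ℝ := fun i => ∑ j, |S.dualFrame c j ⬝ᵥ intVec (S.ray i)|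
  have hB : ∀ x ∈ chartDomain s c, ∀ i, |S.chartAngle s c x ⬝ᵥ intVec (S.ray i)| ≤ B i := by
    intro x hx i
    rw [chartAngle_dotProduct]
    refine (Finset.abs_sum_le_sum_abs _ _).trans (Finset.sum_le_sum fun j _ => ?_)
    split_ifs with h
    · simp
    · have h1 := (hx j).2 h
      rw [abs_mul, abs_of_nonneg h1.1]
      exact mul_le_of_le_one_left (abs_nonneg _) h1.2.le
  refine ⟨Fintype.piFinset fun i => Finset.Icc ⌊-B i⌋ ⌊B i⌋, fun x hx => ?_⟩
  by_cases hint : ∃ i ∈ {i | i ∉ s ∧ insert i s ∈ S.cones}, ∃ m : ℤ,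
      S.chartAngle s c x ⬝ᵥ intVec (S.ray i) = m
  · obtain ⟨i, hi, m, hm⟩ := hint
    exact Or.inr (Set.mem_biUnion hi (Set.mem_iUnion.2 ⟨m, hm⟩))
  · push Not at hint
    refine Or.inl (Set.mem_biUnion
      (x := fun i => ⌊S.chartAngle s c x ⬝ᵥ intVec (S.ray i)⌋) ?_ ⟨fun j => (hx j).1, ?_⟩)
    · rw [Finset.mem_coe, Fintype.mem_piFinset]
      intro i
      have := abs_le.1 (hB x hx i)
      exact Finset.mem_Icc.2 ⟨Int.floor_mono this.1, Int.floor_mono this.2⟩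
    · intro i hi his
      exact ⟨lt_of_le_of_ne (Int.floor_le _) (hint i ⟨hi, his⟩ _).symm, Int.lt_floor_add_one _⟩

/-- The multiplicities of the characteristic cycle take finitely many values on a chart, so they do
not affect integrability. -/
theorem IsFrame.integrableOn_ccMultiplicity_mul (hc : S.IsFrame s c) (F : TorusD n)
    {G : (Fin n → ℝ) → ℂ} (hG : IntegrableOn G (chartDomain s c)) :
    IntegrableOn (fun x =>
      (S.ccMultiplicity F (torusMk (S.chartAngle s c x), S.chartMomentum s c x) : ℂ) * G x)
      (chartDomain s c) := by
  obtain ⟨A, hA⟩ := exists_finset_chartDomain_subset (S := S) (s := s) (c := c)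
  set Z : Set (Fin n → ℝ) := ⋃ i ∈ {i | i ∉ s ∧ insert i s ∈ S.cones}, ⋃ m : ℤ,
    {x | S.chartAngle s c x ⬝ᵥ intVec (S.ray i) = m}
  have hZ : volume Z = 0 := by
    refine (measure_biUnion_null_iff (Set.to_countable _)).2 fun i hi => ?_
    exact measure_iUnion_null fun m => hc.volume_chartAngle_integral_eq_zero hi.1 hi.2 m
  have hsub : chartDomain s c ⊆ (⋃ f ∈ A, chartDomain s c ∩ S.chartCell s c f) ∪ Z := by
    intro x hx
    rcases hA hx with h | h
    · rw [← Set.inter_iUnion₂]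
      exact Or.inl ⟨hx, h⟩
    · exact Or.inr h
  refine IntegrableOn.mono_set ?_ hsub
  refine IntegrableOn.union (integrableOn_finset_iUnion.2 fun f _ => ?_) ?_
  · rcases (S.chartCell s c f).eq_empty_or_nonempty with h | ⟨x₀, hx₀⟩
    · simp [h]
    · refine IntegrableOn.congr_fun (f := fun x => (S.ccMultiplicity F
        (torusMk (S.chartAngle s c x₀), S.chartMomentum s c x₀) : ℂ) * G x)
        ((hG.mono_set Set.inter_subset_left).const_mul _) (fun x hx => ?_)
        (measurableSet_chartDomain.inter (measurableSet_chartCell f))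
      simp only [hc.ccMultiplicity_eq_of_mem_chartCell F hx₀ hx.2]
  · rw [IntegrableOn, Measure.restrict_eq_zero.2 hZ]
    exact integrable_zero_measure

end frame

end SmoothCompleteFan

/-! ### Convergence of the oscillatory integrals -/

theorem Matrix.norm_det_le {n : ℕ} {A : Matrix (Fin n) (Fin n) ℂ} {x : ℝ}
    (h : ∀ i j, ‖A i j‖ ≤ x) : ‖A.det‖ ≤ n.factorial * x ^ n := by
  have h1 : ‖A.det‖ ≤ (Fintype.card (Fin n)).factorial • x ^ Fintype.card (Fin n) :=
    Matrix.det_le (abv := NormedField.toAbsoluteValue ℂ) h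
  rwa [Fintype.card_fin, nsmul_eq_mul] at h1

theorem Measurable.matrix_det {α : Type*} [MeasurableSpace α] {n : ℕ}
    {A : α → Matrix (Fin n) (Fin n) ℂ} (h : ∀ i j, Measurable fun x => A x i j) :
    Measurable fun x => (A x).det := by
  simp only [Matrix.det_apply]
  exact Finset.measurable_fun_sum _ fun σ _ =>
    (Finset.measurable_fun_prod _ fun i _ => h _ _).const_smul _

namespace IsStronglyConvexQuadratic

variable {n : ℕ} {δ : ℝ} {φ : (Fin n → ℝ) → ℝ}

theorem legendre_invFun (h : IsStronglyConvexQuadratic δ φ) (ξ : Fin n → ℝ) :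
    legendre φ (Function.invFun (legendre φ) ξ) = ξ :=
  Function.rightInverse_invFun h.legendre_surjective ξ

theorem norm_invFun_sub_le (h : IsStronglyConvexQuadratic δ φ) (ξ ξ' : Fin n → ℝ) :
    ‖Function.invFun (legendre φ) ξ - Function.invFun (legendre φ) ξ'‖ ≤
      n / (2 * δ) * ‖ξ - ξ'‖ := by
  have := h.norm_sub_le (Function.invFun (legendre φ) ξ) (Function.invFun (legendre φ) ξ')
  rwa [h.legendre_invFun, h.legendre_invFun] at this

end IsStronglyConvexQuadratic

namespace SmoothCompleteFan

variable {n r : ℕ} {S : SmoothCompleteFan n r} {s : Finset (Fin r)} {c : Fin n → Fin r}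
  {δ : ℝ} {φ : (Fin n → ℝ) → ℝ}

theorem exists_lipschitzWith_chartLog (hφ : IsStronglyConvexQuadratic δ φ) :
    ∃ K, LipschitzWith K (S.chartLog φ s c) := by
  have hδ := hφ.pos
  refine ⟨_, LipschitzWith.of_dist_le' (K := n / (2 * δ) * ‖chartMomentumL S s c‖ +
    2 * Real.pi * ‖chartAngleL S s c‖) fun x y => ?_⟩
  rw [dist_eq_norm, dist_eq_norm]
  have hπ := Real.pi_pos
  refine (pi_norm_le_iff_of_nonneg (by positivity)).2 fun l => ?_
  have h1 : S.chartLog φ s c x l - S.chartLog φ s c y l =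
      (((Function.invFun (legendre φ) (S.chartMomentum s c x) -
        Function.invFun (legendre φ) (S.chartMomentum s c y)) l : ℝ) : ℂ) +
      ((2 * Real.pi * (S.chartAngle s c x - S.chartAngle s c y) l : ℝ) : ℂ) * Complex.I := by
    simp only [chartLog, Pi.sub_apply]
    push_cast
    ring
  rw [Pi.sub_apply, h1]
  refine (norm_add_le _ _).trans ?_
  rw [norm_mul, Complex.norm_I, mul_one, Complex.norm_real, Complex.norm_real, add_mul]
  refine add_le_add ?_ ?_
  · refine (norm_le_pi_norm _ l).trans ((hφ.norm_invFun_sub_le _ _).trans ?_)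
    rw [mul_assoc, ← chartMomentumL_apply, ← chartMomentumL_apply, ← map_sub]
    have := (chartMomentumL S s c).le_opNorm (x - y)
    gcongr
  · rw [norm_mul, Real.norm_eq_abs (2 * Real.pi), abs_of_pos Real.two_pi_pos, mul_assoc (2 * Real.pi)]
    refine mul_le_mul_of_nonneg_left ?_ (by positivity)
    refine (norm_le_pi_norm _ l).trans ?_
    rw [← chartAngleL_apply, ← chartAngleL_apply, ← map_sub]
    exact (chartAngleL S s c).le_opNorm (x - y)

theorem measurable_omegaDensity : Measurable (S.omegaDensity φ s c) :=
  Measurable.matrix_det fun l k =>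
    (measurable_pi_apply l).comp (measurable_fderiv_apply_const ℝ (S.chartLog φ s c) (Pi.single k 1))

/-- A Lipschitz constant of the chart bounds `fderiv` at every point, including any where it takes
its default value 0, so the chart need not be shown differentiable. -/
theorem exists_norm_omegaDensity_le (hφ : IsStronglyConvexQuadratic δ φ) :
    ∃ C ≥ 0, ∀ x, ‖S.omegaDensity φ s c x‖ ≤ C := by
  obtain ⟨K, hK⟩ := exists_lipschitzWith_chartLog (S := S) (s := s) (c := c) hφ
  refine ⟨n.factorial * (K : ℝ) ^ n, by positivity, fun x => Matrix.norm_det_le fun l k => ?_⟩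
  refine (norm_le_pi_norm (fderiv ℝ (S.chartLog φ s c) x (Pi.single k 1)) l).trans ?_
  refine (ContinuousLinearMap.le_opNorm _ _).trans ?_
  rw [Pi.norm_single, norm_one, mul_one]
  exact norm_fderiv_le_of_lipschitz ℝ hK

theorem exp_chartLog (x : Fin n → ℝ) :
    (fun l => Complex.exp (S.chartLog φ s c x l)) =
      polar (torusMk (S.chartAngle s c x))
        (Function.invFun (legendre φ) (S.chartMomentum s c x)) := by
  ext l
  rw [chartLog, polar, torusMk, coe_toCircle_coe, Complex.exp_add]

theorem continuous_laurent_exp_chartLog (hφ : IsStronglyConvexQuadratic δ φ) (w : Fin r → ℂ) :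
    Continuous fun x => S.laurent w fun l => Complex.exp (S.chartLog φ s c x l) := by
  obtain ⟨K, hK⟩ := exists_lipschitzWith_chartLog (S := S) (s := s) (c := c) hφ
  refine continuous_finsetSum _ fun i _ => continuous_const.mul (continuous_finsetProd _ fun j _ => ?_)
  exact (Complex.continuous_exp.comp ((continuous_apply j).comp hK.continuous)).zpow₀ _
    fun x => Or.inl (Complex.exp_ne_zero _)

/-- The function is a product over the coordinates: an exponential on a half-line for each ray of σ,
the constant 1 on [0, 1) for each angle. -/
theorem integrableOn_exp_neg_chartDomain {a : ℝ} (ha : 0 < a) :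
    IntegrableOn (fun x : Fin n → ℝ => Real.exp (-(a * ∑ j, if c j ∈ s then x j else 0)))
      (chartDomain s c) := by
  let g : Fin n → ℝ → ℝ := fun j => if c j ∈ s then (Set.Ioi 0).indicator fun t => Real.exp (-a * t)
    else (Set.Ico 0 1).indicator fun _ => 1
  have hg : ∀ j, Integrable (g j) := fun j => by
    by_cases h : c j ∈ s
    · simp only [g, h, if_true]
      exact (integrable_indicator_iff measurableSet_Ioi).2 (exp_neg_integrableOn_Ioi 0 ha)
    · simp only [g, h, if_false]
      exact (integrable_indicator_iff measurableSet_Ico).2 (by simp)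
  have h1 : Integrable fun x : Fin n → ℝ => ∏ j, g j (x j) :=
    Integrable.fintype_prod (f := g) hg
  refine h1.integrableOn.congr_fun (fun x hx => ?_) measurableSet_chartDomain
  simp only
  rw [Finset.mul_sum, ← Finset.sum_neg_distrib, Real.exp_sum]
  refine Finset.prod_congr rfl fun j _ => ?_
  by_cases h : c j ∈ s
  · simp only [g, h, if_true]
    rw [Set.indicator_of_mem (show x j ∈ Set.Ioi 0 from (hx j).1 h), neg_mul]
  · simp only [g, h, if_false]
    rw [Set.indicator_of_mem (show x j ∈ Set.Ico 0 1 from (hx j).2 h)]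
    simp

theorem IsFrame.exists_sum_le_norm_chartMomentum (hc : S.IsFrame s c) :
    ∃ M > 0, ∀ x : Fin n → ℝ,
      ∑ j, (if c j ∈ s then x j else 0) ≤ M * ‖S.chartMomentum s c x‖ := by
  refine ⟨∑ j, n * ‖S.dualFrame c j‖ + 1, by positivity, fun x => ?_⟩
  have h1 : ∑ j, (if c j ∈ s then x j else 0) ≤
      (∑ j, n * ‖S.dualFrame c j‖) * ‖S.chartMomentum s c x‖ := by
    rw [Finset.sum_mul]
    refine Finset.sum_le_sum fun j _ => ?_
    rw [← hc.dualFrame_dotProduct_neg_chartMomentum x j, ← norm_neg (S.chartMomentum s c x)]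
    exact (le_abs_self _).trans (abs_dotProduct_le _ _)
  linarith [norm_nonneg (S.chartMomentum s c x)]

theorem norm_laurent_polar_zero_le (w : Fin r → ℂ) (θ : Torus n) :
    ‖S.laurent w (polar θ 0)‖ ≤ ∑ i, ‖w i‖ := by
  refine (norm_sum_le _ _).trans (Finset.sum_le_sum fun i _ => ?_)
  rw [prod_polar_zpow, norm_mul, norm_mul, norm_torusChar]
  simp

/-- The real part of -W/z is at most (C' - h(ρ))/|z|, and h(ρ) dominates ‖ρ‖, hence the momentum
‖ξ‖, hence the sum of the ray coordinates. Against a bounded density this is an integrable majorant.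
-/
theorem oscillatoryIntegralConverges_of_growth (hφ : IsStronglyConvexQuadratic δ φ)
    (w : Fin r → ℂ) {V : Set (Torus n × (Fin n → ℝ))} (hV : S.IsConicalNhd V) {z : ℂ} (hz : z ≠ 0)
    {C : ℝ} (hC : ∀ (θ : Torus n) (ρ : Fin n → ℝ), (θ, legendre φ ρ) ∈ V →
      S.height ρ - C ≤ (S.laurent w (polar θ ρ) * (‖z‖ / z)).re) (F : TorusD n) :
    S.OscillatoryIntegralConverges φ (S.laurent w) z F := by
  intro s hs c hc
  refine hc.integrableOn_ccMultiplicity_mul F ?_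
  obtain ⟨D, hD0, hD⟩ := exists_norm_omegaDensity_le (S := S) (s := s) (c := c) hφ
  obtain ⟨M, hM0, hM⟩ := hc.exists_sum_le_norm_chartMomentum
  obtain ⟨L, hL0, hL⟩ := hφ.exists_norm_legendre_le
  obtain ⟨h₀, hh0, hh⟩ := S.exists_mul_norm_le_height
  have hz0 := norm_pos_iff.2 hz
  -- The second entry covers zero momentum, which `V` excludes: there ρ = 0 and |W| ≤ ∑‖w_i‖.
  set C' : ℝ := max C (∑ i, ‖w i‖)
  set a : ℝ := h₀ / (L * M * ‖z‖)
  have ha : 0 < a := by positivity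
  have hunit : ‖(‖z‖ / z : ℂ)‖ = 1 := by
    rw [norm_div, Complex.norm_real, norm_norm, div_self hz0.ne']
  have hbound : ∀ x ∈ chartDomain s c,
      ‖Complex.exp (-S.laurent w (fun l => Complex.exp (S.chartLog φ s c x l)) / z) *
        S.omegaDensity φ s c x‖ ≤
      Real.exp (C' / ‖z‖) * D * Real.exp (-(a * ∑ j, if c j ∈ s then x j else 0)) := by
    intro x hx
    rw [exp_chartLog]
    set ξ := S.chartMomentum s c x with hξ
    set ρ := Function.invFun (legendre φ) ξ with hρ
    set W := S.laurent w (polar (torusMk (S.chartAngle s c x)) ρ) with hW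
    have hLρ : legendre φ ρ = ξ := hφ.legendre_invFun ξ
    have h1 : S.height ρ - C' ≤ (W * (‖z‖ / z)).re := by
      rcases eq_or_ne ξ 0 with h0 | h0
      · have hρ0 : ρ = 0 := hφ.legendre_injective (by rw [hLρ, h0, hφ.legendre_zero])
        have h2 : ‖W‖ ≤ ∑ i, ‖w i‖ := by
          rw [hW, hρ0]
          exact norm_laurent_polar_zero_le w _
        have h3 := (abs_le.1 (Complex.abs_re_le_norm (W * (‖z‖ / z)))).1
        rw [norm_mul, hunit, mul_one] at h3
        have h4 : S.height ρ = 0 := by rw [hρ0]; simp [height]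
        have h5 : ∑ i, ‖w i‖ ≤ C' := le_max_right _ _
        linarith
      · have hmem : (torusMk (S.chartAngle s c x), ξ) ∈ V := by
          refine hV.2.2.2 _ ?_ h0
          exact Set.mem_biUnion hs (hc.mem_skeletonPiece fun j hj => ((hx j).1 hj).le)
        have h2 := hC (torusMk (S.chartAngle s c x)) ρ (by rw [hLρ]; exact hmem)
        have h3 : C ≤ C' := le_max_left _ _
        linarith
    have h2 : h₀ / (L * M) * ∑ j, (if c j ∈ s then x j else 0) ≤ S.height ρ := by
      refine le_trans ?_ (hh ρ)
      have h3 : ‖ξ‖ ≤ L * ‖ρ‖ := by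
        rw [← hLρ]
        exact hL ρ
      have h4 := hM x
      have h5 : ∑ j, (if c j ∈ s then x j else 0) ≤ M * (L * ‖ρ‖) :=
        h4.trans (mul_le_mul_of_nonneg_left h3 hM0.le)
      rw [div_mul_eq_mul_div, div_le_iff₀ (by positivity)]
      nlinarith
    have h3 : (-W / z).re = -((W * (‖z‖ / z)).re / ‖z‖) := by
      have h4 : -W / z = ((-‖z‖⁻¹ : ℝ) : ℂ) * (W * (‖z‖ / z)) := by
        have : (‖z‖ : ℂ) ≠ 0 := by simpa using hz
        push_cast
        field_simp
      rw [h4, Complex.re_ofReal_mul, div_eq_inv_mul]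
      ring
    have h4 : (-W / z).re ≤ C' / ‖z‖ + -(a * ∑ j, if c j ∈ s then x j else 0) := by
      rw [h3]
      have h5 : (h₀ / (L * M) * ∑ j, (if c j ∈ s then x j else 0) - C') / ‖z‖ ≤
          (W * (‖z‖ / z)).re / ‖z‖ := by
        gcongr
        linarith
      have h6 : (h₀ / (L * M) * ∑ j, (if c j ∈ s then x j else 0) - C') / ‖z‖ =
          a * (∑ j, if c j ∈ s then x j else 0) - C' / ‖z‖ := by
        simp only [a]
        field_simp
      linarith
    rw [norm_mul, Complex.norm_exp]
    calc Real.exp (-W / z).re * ‖S.omegaDensity φ s c x‖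
        ≤ Real.exp (C' / ‖z‖ + -(a * ∑ j, if c j ∈ s then x j else 0)) * D := by
          have := hD x
          have := Real.exp_le_exp.2 h4
          gcongr
      _ = _ := by rw [Real.exp_add]; ring
  refine Integrable.mono' ((integrableOn_exp_neg_chartDomain ha).const_mul
    (Real.exp (C' / ‖z‖) * D)) ?_ ?_
  · have h1 := (continuous_laurent_exp_chartLog (S := S) (s := s) (c := c) hφ w).neg.div_const z
    exact ((Complex.continuous_exp.comp h1).measurable.mul
      measurable_omegaDensity).aestronglyMeasurable
  · exact (ae_restrict_iff' measurableSet_chartDomain).2 (Filter.Eventually.of_forall hbound)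

end SmoothCompleteFan

/-! ### The main theorem -/

theorem Complex.sin_le_re_norm_div {z : ℂ} (hz : z ≠ 0) {ε : ℝ} (hε : 0 ≤ ε)
    (h : |z.arg| ≤ Real.pi / 2 - ε) : Real.sin ε ≤ ((‖z‖ : ℂ) / z).re := by
  have h1 : ((‖z‖ : ℂ) / z).re = Real.cos |z.arg| := by
    have hz0 := norm_pos_iff.2 hz
    rw [Real.cos_abs, Complex.cos_arg hz, Complex.div_re, Complex.normSq_eq_norm_sq]
    simp
    field_simp
  rw [h1, ← Real.cos_pi_div_two_sub]
  exact Real.cos_le_cos_of_nonneg_of_le_pi (abs_nonneg _) (by linarith [Real.pi_pos]) h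

theorem mainTheorem8 {n r : ℕ} (S : SmoothCompleteFan n r) (hFano : S.IsFano) :
    ∃ φ : (Fin n → ℝ) → ℝ, S.IsPotential φ ∧
      ∀ (k : ℕ) (e : Module.Basis (Fin k) ℤ S.relLattice), S.IsNefBasis e →
      ∀ η : (Fin r → ℤ) →ₗ[ℤ] S.relLattice, (∀ l : S.relLattice, η l = l) →
      ∀ ε'' > (0 : ℝ), ∀ ε > (0 : ℝ), ∃ ε' > (0 : ℝ), ∀ q ∈ paramRegion k ε ε',
        (∃ V K : Set (Torus n × (Fin n → ℝ)), S.IsConicalNhd V ∧ IsCompact K ∧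
          ∀ (θ : Torus n) (ρ : Fin n → ℝ), (θ, legendre φ ρ) ∈ V \ K →
            S.superpotential e η q (polar θ ρ) ≠ 0 ∧
            |(S.superpotential e η q (polar θ ρ)).arg| < ε'') ∧
        ∀ z : ℂ, z ≠ 0 → |z.arg| ≤ Real.pi / 2 - ε'' →
          ∀ F : S.skeletonSheaves.FullSubcategory, S.IsWrapped F →
            S.OscillatoryIntegralConverges φ (S.superpotential e η q) z F.obj := by
  obtain ⟨δ, φ, hpot, hφ, τ, hτ, κ, hκ, hnear⟩ := S.exists_isPotential hFano
  refine ⟨φ, hpot, fun k e _ η _ ε'' hε'' ε _ => ?_⟩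
  have hπ := Real.pi_pos
  -- Shrinking ε'' below π/2 makes the angular bound stronger and widens the range of z, so nothing
  -- is lost.
  obtain ⟨ε₀, hε₀, hε₀', hε₀π⟩ : ∃ ε₀ > 0, ε₀ ≤ ε'' ∧ ε₀ < Real.pi / 2 :=
    ⟨min ε'' (Real.pi / 4), lt_min hε'' (by positivity), min_le_left _ _,
      (min_le_right _ _).trans_lt (by linarith)⟩
  have hσ : 0 < Real.sin ε₀ := Real.sin_pos_of_pos_of_lt_pi hε₀ (by linarith)
  let N : ℝ := ∑ i, ∑ a, |(e.repr (η (Pi.single i 1)) a : ℝ)|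
  have hN : 0 ≤ N := by positivity
  -- The phase of each coefficient is at most N times the bound on the arguments; it must stay
  -- within σ/4 with σ = sin ε₀. The potential was fixed before, so only ε' depends on the
  -- splitting.
  refine ⟨Real.sin ε₀ / 4 / (N + 1), by positivity, fun q hq => ?_⟩
  have hq0 : ∀ a, q a ≠ 0 := fun a => (hq a).1
  have hc : ∀ i, S.coeff e η q i ≠ 0 := fun i =>
    Finset.prod_ne_zero_iff.2 fun a _ => zpow_ne_zero _ (hq0 a)
  have hcσ : ∀ i, ‖S.coeff e η q i / ‖S.coeff e η q i‖ - 1‖ ≤ Real.sin ε₀ / 4 := fun i => by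
    refine (norm_prod_zpow_div_norm_sub_one_le _ hq0 (ε := Real.sin ε₀ / 4 / (N + 1))
      fun a => abs_le.2 ⟨(hq a).2.2.1.le, (hq a).2.2.2.le⟩).trans ?_
    have h1 : ∑ a, |(e.repr (η (Pi.single i 1)) a : ℝ)| ≤ N :=
      Finset.single_le_sum (f := fun i => ∑ a, |(e.repr (η (Pi.single i 1)) a : ℝ)|)
        (fun _ _ => by positivity) (Finset.mem_univ i)
    calc _ ≤ (N + 1) * (Real.sin ε₀ / 4 / (N + 1)) := by
          gcongr
          linarith
      _ = Real.sin ε₀ / 4 := mul_div_cancel₀ _ (by positivity)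
  obtain ⟨C, hC⟩ := S.exists_growth hφ hτ hnear hc hσ hcσ
  have hV := S.isConicalNhd_coneNhd hκ (show 0 < Real.sin ε₀ / 4 by positivity)
  refine ⟨⟨S.coneNhd κ (Real.sin ε₀ / 4), ?_⟩, fun z hz harg F _ => ?_⟩
  · obtain ⟨h₀, hh0, hh⟩ := S.exists_mul_norm_le_height
    obtain ⟨L, hL0, hL⟩ := hφ.exists_norm_legendre_le
    -- Outside this ball ‖ρ‖ > |C|/h₀, so the gauge exceeds C and the growth bound is positive.
    refine ⟨Set.univ ×ˢ Metric.closedBall 0 (L * (|C| / h₀)), hV,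
      isCompact_univ.prod (isCompact_closedBall _ _), fun θ ρ hmem => ?_⟩
    have hρ : |C| < S.height ρ := by
      have h1 : L * (|C| / h₀) < ‖legendre φ ρ‖ := by
        by_contra! hle
        exact hmem.2 ⟨Set.mem_univ _, by simpa using hle⟩
      have h2 := lt_of_mul_lt_mul_left (h1.trans_le (hL ρ)) hL0.le
      rw [div_lt_iff₀ hh0] at h2
      linarith [hh ρ]
    have h1 := Complex.abs_arg_lt_of_re_mul_pos (w := S.superpotential e η q (polar θ ρ)) hε₀ hε₀π
      fun ζ hζ hζre => by
        have h2 := hC θ ρ hmem.1 ζ hζ hζre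
        have h3 : 0 < S.height ρ - C := by linarith [le_abs_self C]
        exact h3.trans_le h2
    exact ⟨h1.1, h1.2.trans_le hε₀'⟩
  · have hunit : ‖(‖z‖ / z : ℂ)‖ = 1 := by
      rw [norm_div, Complex.norm_real, norm_norm, div_self (norm_ne_zero_iff.2 hz)]
    exact SmoothCompleteFan.oscillatoryIntegralConverges_of_growth hφ (S.coeff e η q) hV hz
      (fun θ ρ hmem => hC θ ρ hmem _ hunit
        (Complex.sin_le_re_norm_div hz hε₀.le (harg.trans (by linarith)))) F.obj
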